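/- **Setting.** Let $n,m\ge 1$, $\gamma\in(0,1)$ and $B\ge 1$ be given. *Network.* For $t=0,1,2,\dots$ let $\mathcal G_t$ be a digraph with node set $\{1,\dots,n\}$ and edge set $\mathcal E_t$ that contains all self-loops $(i,i)$, and let $A_t=[a_{ij,t}]\in\mathbb R^{n\times n}$ satisfy: $a_{ij,t}>0$ if $(j,i)\in\mathcal E_t$ and $a_{ij,t}=0$ otherwise; every nonzero $a_{ij,t}$ is at least $\gamma$; $\sum_{i}a_{ij,t}=1$ for all $j$ and $t$; and for every $t\ge 0$ the digraph with edge set $\mathcal E_t\cup\dots\cup\mathcal E_{t+B-1}$ is strongly connected. Put $\phi_{i,0}=1$, $\phi_{i,t+1}=\sum_j a_{ij,t}\phi_{j,t}$, $b_{ij,t}=a_{ij,t}\phi_{j,t}/\phi_{i,t+1}$, $\mathcal B_t=[b_{ij,t}]$, and $\mathcal B(s:t)=\mathcal B_{s-1}\cdots\mathcal B_t$ for $s\ge t$, with $\mathcal B(t:t)=I$. *Costs.* Let $\Omega\subseteq\mathbb R^m$ be closed and convex with $r\mathbb B\subseteq\Omega\subseteq R\,\mathbb B$ for some $r,R>0$,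 where $\mathbb B$ is the closed unit ball. For $1\le i\le n$ and $t\ge 0$ let $f_{i,t}$ be a convex function on $\Omega$ which has at every point of $\Omega$ a subgradient of norm at most $G$, where $G>0$. Let $x_t^\star\in\arg\min_{x\in\Omega}\sum_i f_{i,t}(x)$ and $\mathcal C_T=\sum_{t=0}^{T}\|x_{t+1}^\star-x_t^\star\|$. *Algorithm.* Let $\xi\in(0,1)$, $\mu\in(0,r\xi]$, let $\alpha_0\ge\alpha_1\ge\dots>0$, and let $x_{i,0}\in(1-\xi)\Omega$ be deterministic. Let $\zeta_{i,t}$ be random vectors, each uniformly distributed on the unit sphere of $\mathbb R^m$ and independent of the family $(\zeta_{j,s})_{1\le j\le n,\,s<t}$. Let $\mathcal P$ be the Euclidean projection onto $(1-\xi)\Omega$, and for $t\ge0$ put $$x_{i,t+1}=\mathcal P\Big(\sum_{j}b_{ij,t}x_{j,t}-\frac{\alpha_t}{\phi_{i,t+1}}\hat g_{i,t}\Big),\qquad \hat g_{i,t}=\frac m\mu\big(f_{i,t}(x_{i,t}+\mu\zeta_{i,t})-f_{i,t}(x_{i,t})\big)\zeta_{i,t}.$$ **Theorem.** (i) There are constants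 $C>0$, $\lambda\in(0,1)$ and $\theta>0$, depending only on $n$, $\gamma$ and $B$, such that for every network as above there are vectors $\pi_t=(\pi_{1,t},\dots,\pi_{n,t})$, $t\ge0$, with $\sum_i\pi_{i,t}=1$, with all $\pi_{i,t}$ bounded below by a common positive constant, and with $$|[\mathcal B(s:t)]_{ij}-\pi_{j,t}|\le C\lambda^{s-t}\ (s\ge t),\qquad \pi_t^{\mathsf T}=\pi_{t+1}^{\mathsf T}\mathcal B_t,\qquad \phi_{i,t}\ge\theta^{-1}.$$ (ii) For all $C>0$, $\lambda\in(0,1)$, $\theta>0$ and $\pi_t$ with the properties in (i) for the given network, put $\bar x_t=\sum_i\pi_{i,t}x_{i,t}$ and $L=mG/\mu$. Then the random variables $f_{i,t}(\bar x_t)-f_{i,t}(x_t^\star)$ are integrable, and for every $T\ge 0$ $$\begin{aligned}\sum_{t=0}^{T}\sum_{i=1}^{n}\frac{\pi_{i,t+1}}{\phi_{i,t+1}}\,\mathbb E\big[f_{i,t}(\bar x_t)-f_{i,t}(x_t^\star)\big]\le{}&2nm\theta^2RLCG\sum_{t=0}^{T}\sum_{l=1}^{t}\lambda^{t-l}\alpha_{l-1}+\frac{m^2\theta^2G^2}{2}\sum_{t=0}^{T}\alpha_t\\&+2nm^2\theta^2CG^2\sum_{t=0}^{T}\sum_{l=1}^{t+1}\lambda^{t+1-l}\alpha_{l-1}+\frac{2R^2}{\alpha_T}\\&+2(RL+mG\lambda)\theta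 C\sum_{j=1}^{n}\|x_{j,0}\|\sum_{t=0}^{T}\lambda^t+\frac{2R}{\alpha_T}\mathcal C_T\\&+\mu\theta G(T+1)+\theta\xi GR(T+1).\end{aligned}$$ -/

import Mathlib

open MeasureTheory ProbabilityTheory
open scoped Pointwise

namespace BanditOnline

noncomputable section

/-- The Euclidean space `ℝᵐ`. -/
abbrev Vec (m : ℕ) : Type := EuclideanSpace ℝ (Fin m)

/-- The unit sphere of `ℝᵐ`. -/
abbrev UnitSphere (m : ℕ) : Type := Metric.sphere (0 : Vec m) 1

/-- The uniform distribution on the unit sphere of `ℝᵐ`: the normalized surface measure. -/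
def uniformSphere (m : ℕ) : Measure (UnitSphere m) :=
  ((volume : Measure (Vec m)).toSphere Set.univ)⁻¹ • (volume : Measure (Vec m)).toSphere

/-- The assumptions on the time-varying digraphs and on their weight matrices. `(𝒢 t).Adj i j` means
that node `j` receives information from node `i` at round `t`, and `A t i j` is the weight `a_{ij,t}`
that node `i` gives to node `j`. Every node is an in-neighbour of itself. -/
structure NetworkAssumption {n : ℕ} (𝒢 : ℕ → Digraph (Fin n)) (A : ℕ → Matrix (Fin n) (Fin n) ℝ)
    (γ : ℝ) (B : ℕ) : Prop where
  self_loop : ∀ t i, (𝒢 t).Adj i i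
  weight_pos : ∀ t i j, (𝒢 t).Adj j i → 0 < A t i j
  weight_zero : ∀ t i j, ¬ (𝒢 t).Adj j i → A t i j = 0
  lower_bound : ∀ t i j, A t i j ≠ 0 → γ ≤ A t i j
  column_stochastic : ∀ t j, ∑ i, A t i j = 1
  /-- The union of any `B` consecutive digraphs is strongly connected. -/
  jointly_connected : ∀ t i j,
    Relation.ReflTransGen (fun k l : Fin n => ∃ s < B, (𝒢 (t + s)).Adj k l) i j

/-- The scalars `φ_{i,t}`: `φ_{i,0} = 1` and `φ_{i,t+1} = ∑ j, a_{ij,t} φ_{j,t}`. -/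
def phi {n : ℕ} (A : ℕ → Matrix (Fin n) (Fin n) ℝ) : ℕ → Fin n → ℝ
  | 0 => fun _ => 1
  | t + 1 => fun i => ∑ j, A t i j * phi A t j

/-- The matrices `ℬ_t` with entries `b_{ij,t} = a_{ij,t} φ_{j,t} / φ_{i,t+1}`. -/
def mixing {n : ℕ} (A : ℕ → Matrix (Fin n) (Fin n) ℝ) (t : ℕ) : Matrix (Fin n) (Fin n) ℝ :=
  Matrix.of fun i j => 1 / phi A (t + 1) i * A t i j * phi A t j

/-- `transition A t k` is the product `ℬ_{t+k-1} ⋯ ℬ_t`, that is `ℬ(t+k : t)`. -/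
def transition {n : ℕ} (A : ℕ → Matrix (Fin n) (Fin n) ℝ) (t : ℕ) : ℕ → Matrix (Fin n) (Fin n) ℝ
  | 0 => 1
  | k + 1 => mixing A (t + k) * transition A t k

/-- `π` is the sequence of normalized vectors towards whose entries the products of the matrices
`ℬ_t` converge, with geometric rate `C λ ^ (s - t)`, and `θ⁻¹` is a lower bound for the `φ_{i,t}`. -/
structure MixingData {n : ℕ} (A : ℕ → Matrix (Fin n) (Fin n) ℝ) (π : ℕ → Fin n → ℝ)
    (C lam θ : ℝ) : Prop where
  sum_eq_one : ∀ t, ∑ i, π t i = 1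
  geometric : ∀ t k i j, |transition A t k i j - π t j| ≤ C * lam ^ k
  bounded_below : ∃ β > 0, ∀ t i, β ≤ π t i
  left_invariant : ∀ t, π t = Matrix.vecMul (π (t + 1)) (mixing A t)
  phi_bounded_below : ∀ t i, θ⁻¹ ≤ phi A t i

/-- `g` is a subgradient at `x` of the function `f` on `K`. -/
def IsSubgradient {m : ℕ} (K : Set (Vec m)) (f : Vec m → ℝ) (x g : Vec m) : Prop :=
  ∀ y ∈ K, f x + inner ℝ g (y - x) ≤ f y

/-- The assumptions on the constraint set `K` and on the cost functions `f i t`. Only the values of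
the cost functions on `K` matter. At a boundary point of `K` a function given on `K` only has
unboundedly large subgradients, so the bound is asked for a subgradient at each point; for a finite
convex function on the whole space, it follows if all its subgradients at points of `K` are bounded
by `G`. -/
structure CostAssumption {n m : ℕ} (K : Set (Vec m)) (r R G : ℝ)
    (f : Fin n → ℕ → Vec m → ℝ) : Prop where
  convex_set : Convex ℝ K
  closed_set : IsClosed K
  r_pos : 0 < r
  R_pos : 0 < R
  ball_subset : Metric.closedBall 0 r ⊆ K
  subset_ball : K ⊆ Metric.closedBall 0 R
  convex_cost : ∀ i t, ConvexOn ℝ K (f i t)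
  G_pos : 0 < G
  bounded_subgradient : ∀ i t, ∀ x ∈ K, ∃ g, IsSubgradient K (f i t) x g ∧ ‖g‖ ≤ G

/-- The Euclidean projection onto `K`: a point of `K` that minimizes `‖w - y‖ ^ 2` over `w ∈ K`
(it exists and is unique if `K` is non-empty, closed and convex). -/
def proj {m : ℕ} (K : Set (Vec m)) (y : Vec m) : Vec m :=
  Classical.epsilon fun z => z ∈ K ∧ IsMinOn (fun w => ‖w - y‖ ^ 2) K z

/-- The two-point zeroth-order oracle `(m / μ) (f (x + μ ζ) - f x) ζ`. -/
def oracle {m : ℕ} (f : Vec m → ℝ) (μ : ℝ) (ζ : UnitSphere m) (x : Vec m) : Vec m :=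
  ((m : ℝ) / μ * (f (x + μ • (ζ : Vec m)) - f x)) • (ζ : Vec m)

/-- The decisions `x_{i,t}` of the algorithm, for a realization `z i t` of the random directions. -/
def decision {n m : ℕ} (A : ℕ → Matrix (Fin n) (Fin n) ℝ) (K : Set (Vec m)) (ξ μ : ℝ)
    (α : ℕ → ℝ) (f : Fin n → ℕ → Vec m → ℝ) (x₀ : Fin n → Vec m)
    (z : Fin n → ℕ → UnitSphere m) : ℕ → Fin n → Vec m
  | 0 => x₀
  | t + 1 => fun i =>
      proj ((1 - ξ) • K)
        (∑ j, mixing A t i j • decision A K ξ μ α f x₀ z t j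
          - (1 / phi A (t + 1) i * α t) •
              oracle (f i t) μ (z i t) (decision A K ξ μ α f x₀ z t i))

/-- The weighted mean `x̄_t = ∑ i, π_{i,t} x_{i,t}` of the decisions. -/
def weightedMean {n m : ℕ} (π : ℕ → Fin n → ℝ) (x : ℕ → Fin n → Vec m) (t : ℕ) : Vec m :=
  ∑ i, π t i • x t i

/-- The random directions `ζ_{i,t}`: each is uniformly distributed on the unit sphere and
independent of the directions of the earlier rounds. -/
structure RandomDirections {n m : ℕ} {S : Type*} [MeasurableSpace S] (P : Measure S)
    (ζ : Fin n → ℕ → S → UnitSphere m) : Prop where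
  measurable : ∀ i t, Measurable (ζ i t)
  uniform : ∀ i t, P.map (ζ i t) = uniformSphere m
  indep_past : ∀ i t,
    Indep (MeasurableSpace.comap (ζ i t) inferInstance)
      (⨆ s, ⨆ (_ : s < t), ⨆ j, MeasurableSpace.comap (ζ j s) inferInstance) P

/-- `xs t` minimizes the global cost `∑ i, f i t` over `K` at every round `t`. -/
def IsMinimizerSequence {n m : ℕ} (K : Set (Vec m)) (f : Fin n → ℕ → Vec m → ℝ)
    (xs : ℕ → Vec m) : Prop :=
  ∀ t, xs t ∈ K ∧ IsMinOn (fun x => ∑ i, f i t x) K (xs t)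

/-- The path variation `C_T = ∑_{t=0}^{T} ‖x*_{t+1} - x*_t‖`. -/
def pathVariation {m : ℕ} (xs : ℕ → Vec m) (T : ℕ) : ℝ :=
  ∑ t ∈ Finset.range (T + 1), ‖xs (t + 1) - xs t‖

end

end BanditOnline

/-! Part (i). Joint connectivity and the self-loops make every entry of a product of `n * B`
consecutive weight matrices at least `γ ^ (n * B)`: the set of nodes reached from a given node grows
in each period until it is full (`le_card_reached`). Since the total mass `∑ i, φ_{i,t} = n` is
conserved, this bounds the `φ_{i,t}` below (`pow_le_phi`). The product `ℬ(s:t)` is the corresponding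
product of the `A_t` conjugated by the diagonal matrices of the `φ`, so it is row stochastic and its
blocks of length `n * B` have entries at least some `δ > 0`. Each block therefore shrinks the range
of every column by the factor `1 - δ`; the columns become constant geometrically fast, and the
constants are the `π_{j,t}` (`exists_mixingData`).

Part (ii) combines three facts. Consensus: as `π_t = π_{t+1} ℬ_t`, the distance of the `x_{i,t}` to
their weighted mean obeys a linear recursion with contraction `λ`, driven by steps of size at most
`θ α_t m G` (`norm_sum_transition_sub_le`). Descent: mixing does not increase the weighted square
distance to a point, so the projected gradient computation bounds the linearized regret against `(1
- ξ) x*_t`, and the path variation pays for the moving comparator (`sum_inner_le_of_projected_step`,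
`sum_weighted_spread_le`); both bounds hold along every trajectory. Oracle: in expectation, the
inner product of the oracle with `x - y` is at least `f x - f y - μ G`
(`sub_le_integral_inner_oracle`), and independence from the past lets `x` be the random decision.
Passing to the weighted mean and to `x*_t` costs Lipschitz terms.

The oracle inequality needs no smoothness of `f`. The line derivative of a Lipschitz function is
integrated by parts against a truncated cone of height `ε`. Divided by `ε`, one side tends to an
integral over a ball, where convexity applies, and the other to an integral over its boundary
sphere. -/

namespace BanditOnline

/-! ### Products of the weight matrices -/

section Network

variable {n : ℕ} {𝒢 : ℕ → Digraph (Fin n)} {A : ℕ → Matrix (Fin n) (Fin n) ℝ} {γ : ℝ} {B : ℕ}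

/-- The product `A_{t+k-1} ⋯ A_t` of consecutive weight matrices. -/
def weightProd (A : ℕ → Matrix (Fin n) (Fin n) ℝ) (t : ℕ) : ℕ → Matrix (Fin n) (Fin n) ℝ
  | 0 => 1
  | k + 1 => A (t + k) * weightProd A t k

theorem NetworkAssumption.weight_nonneg (h : NetworkAssumption 𝒢 A γ B) (t : ℕ) (i j : Fin n) :
    0 ≤ A t i j := by
  by_cases hij : (𝒢 t).Adj j i
  · exact (h.weight_pos t i j hij).le
  · exact (h.weight_zero t i j hij).ge

theorem NetworkAssumption.le_weight (h : NetworkAssumption 𝒢 A γ B) {t : ℕ} {i j : Fin n}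
    (hij : (𝒢 t).Adj j i) : γ ≤ A t i j :=
  h.lower_bound t i j (h.weight_pos t i j hij).ne'

theorem weightProd_nonneg (hA : ∀ t i j, 0 ≤ A t i j) (t k : ℕ) (i j : Fin n) :
    0 ≤ weightProd A t k i j := by
  induction k generalizing i with
  | zero =>
    rw [weightProd, Matrix.one_apply]
    split_ifs <;> norm_num
  | succ k ih =>
    rw [weightProd, Matrix.mul_apply]
    exact Finset.sum_nonneg fun l _ => mul_nonneg (hA _ _ _) (ih l)

theorem phi_add (A : ℕ → Matrix (Fin n) (Fin n) ℝ) (t k : ℕ) (i : Fin n) :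
    phi A (t + k) i = ∑ j, weightProd A t k i j * phi A t j := by
  induction k generalizing i with
  | zero => simp [weightProd, Matrix.one_apply]
  | succ k ih =>
    rw [← add_assoc, phi]
    simp only [weightProd, Matrix.mul_apply, ih, Finset.mul_sum, Finset.sum_mul]
    rw [Finset.sum_comm]
    simp only [mul_assoc]

/-- The factors `φ` telescope in the product; lower bounds for products of the `A_t` thus pass to
products of the `ℬ_t`. -/
theorem transition_apply (hφ : ∀ t i, phi A t i ≠ 0) (t k : ℕ) (i j : Fin n) :
    transition A t k i j = weightProd A t k i j * phi A t j / phi A (t + k) i := by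
  induction k generalizing i with
  | zero =>
    by_cases hij : i = j
    · subst hij; simp [transition, weightProd, hφ t i]
    · simp [transition, weightProd, hij]
  | succ k ih =>
    simp only [transition, weightProd, Matrix.mul_apply, ih, mixing, Matrix.of_apply,
      Finset.sum_mul, Finset.sum_div]
    refine Finset.sum_congr rfl fun l _ => ?_
    rw [← add_assoc]
    field_simp [hφ (t + k) l, hφ (t + k + 1) i]

theorem sum_phi (h : NetworkAssumption 𝒢 A γ B) (t : ℕ) : ∑ i, phi A t i = n := by
  induction t with
  | zero => simp [phi]
  | succ t ih =>
    simp only [phi]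
    rw [Finset.sum_comm]
    simp only [← Finset.sum_mul, h.column_stochastic, one_mul, ih]

/-- An entry of the product sums the weights of all walks, and extending one walk by an edge costs
at most a factor `γ`. -/
theorem pow_le_weightProd_succ (h : NetworkAssumption 𝒢 A γ B) (hγ : 0 ≤ γ) {t k : ℕ}
    {i j l : Fin n} (hil : (𝒢 (t + k)).Adj i l) (hi : γ ^ k ≤ weightProd A t k i j) :
    γ ^ (k + 1) ≤ weightProd A t (k + 1) l j := by
  rw [weightProd, Matrix.mul_apply, pow_succ']
  calc γ * γ ^ k ≤ A (t + k) l i * weightProd A t k i j :=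
        mul_le_mul (h.le_weight hil) hi (pow_nonneg hγ k) (h.weight_nonneg _ _ _)
    _ ≤ _ := Finset.single_le_sum
        (f := fun p => A (t + k) l p * weightProd A t k p j)
        (fun p _ => mul_nonneg (h.weight_nonneg _ _ _)
          (weightProd_nonneg h.weight_nonneg _ _ _ _)) (Finset.mem_univ i)

theorem pow_le_weightProd_add (h : NetworkAssumption 𝒢 A γ B) (hγ : 0 ≤ γ) {t k : ℕ}
    {i j : Fin n} (hi : γ ^ k ≤ weightProd A t k i j) (p : ℕ) :
    γ ^ (k + p) ≤ weightProd A t (k + p) i j := by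
  induction p with
  | zero => exact hi
  | succ p ih => exact pow_le_weightProd_succ h hγ (h.self_loop _ i) ih

theorem exists_crossing_of_reflTransGen {α : Type*} {r : α → α → Prop} {s : Set α} {a b : α}
    (hab : Relation.ReflTransGen r a b) (ha : a ∈ s) (hb : b ∉ s) :
    ∃ x ∈ s, ∃ y ∉ s, r x y := by
  induction hab with
  | refl => exact absurd ha hb
  | @tail c d _ hcd ih =>
    by_cases hc : c ∈ s
    · exact ⟨c, hc, d, hb, hcd⟩
    · exact ih hc

open Classical in
/-- The nodes that a node reaches with a definite weight increase in number over each period. -/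
theorem le_card_reached (h : NetworkAssumption 𝒢 A γ B) (hγ : 0 ≤ γ) (t : ℕ) (j : Fin n) (k : ℕ) :
    min n (k + 1) ≤
      (Finset.univ.filter fun i => γ ^ (k * B) ≤ weightProd A t (k * B) i j).card := by
  induction k with
  | zero =>
    refine (min_le_right _ _).trans ?_
    rw [zero_add, Nat.succ_le_iff, Finset.card_pos]
    exact ⟨j, by simp [weightProd]⟩
  | succ k ih =>
    set s := Finset.univ.filter fun i => γ ^ (k * B) ≤ weightProd A t (k * B) i j with hs
    set s' := Finset.univ.filter fun i =>
      γ ^ ((k + 1) * B) ≤ weightProd A t ((k + 1) * B) i j with hs'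
    have hsub : s ⊆ s' := by
      intro i hi
      simp only [hs, hs', Finset.mem_filter, Finset.mem_univ, true_and, add_mul, one_mul] at hi ⊢
      exact pow_le_weightProd_add h hγ hi B
    by_cases hfull : s = Finset.univ
    · have : s' = Finset.univ := Finset.univ_subset_iff.1 (hfull ▸ hsub)
      rw [this, Finset.card_univ, Fintype.card_fin]
      exact min_le_left _ _
    · obtain ⟨b, hb⟩ : ∃ b, b ∉ s := by
        by_contra! hc
        exact hfull (Finset.eq_univ_of_forall hc)
      have hpos : 0 < s.card := by
        have hn : 0 < n := j.pos
        omega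
      obtain ⟨a, ha⟩ := Finset.card_pos.1 hpos
      -- A walk in the union graph of this period from a reached to an unreached node leaves `s`
      -- along some edge, present at round `q` of the period.
      obtain ⟨x, hx, y, hy, q, hqB, hxy⟩ := exists_crossing_of_reflTransGen (s := (s : Set (Fin n)))
        (h.jointly_connected (t + k * B) a b) ha hb
      have hys' : y ∈ s' := by
        have hx' : γ ^ (k * B) ≤ weightProd A t (k * B) x j := by
          simpa [hs] using hx
        -- Stay at `x` for `q` rounds by self-loops, cross to `y`, then stay there for the remaining
        -- `B - (q + 1)` rounds.
        have h1 := pow_le_weightProd_add h hγ hx' q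
        rw [add_assoc] at hxy
        have h2 := pow_le_weightProd_succ h hγ hxy h1
        have h3 := pow_le_weightProd_add h hγ h2 (B - (q + 1))
        have he : k * B + q + 1 + (B - (q + 1)) = (k + 1) * B := by
          rw [add_mul, one_mul]; omega
        rw [he] at h3
        simpa [hs'] using h3
      have : s.card < s'.card := Finset.card_lt_card
        (Finset.ssubset_iff_of_subset hsub |>.2 ⟨y, hys', hy⟩)
      omega

theorem pow_le_weightProd (h : NetworkAssumption 𝒢 A γ B) (hγ : 0 ≤ γ) (t : ℕ) (i j : Fin n) :
    γ ^ (n * B) ≤ weightProd A t (n * B) i j := by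
  classical
  have h1 := le_card_reached h hγ t j n
  rw [min_eq_left (Nat.le_succ n)] at h1
  have h2 : (Finset.univ.filter fun i =>
      γ ^ (n * B) ≤ weightProd A t (n * B) i j) = Finset.univ :=
    Finset.eq_univ_of_card _ (le_antisymm (Finset.card_le_univ _) (by simpa using h1))
  have := Finset.mem_univ i
  rw [← h2] at this
  simpa using this

/-- After `n * B` rounds every node holds at least the fraction `γ ^ (n * B)` of the conserved mass
`n`. Before that, the self-loop alone preserves `γ ^ t` of its initial mass `1`. -/
theorem pow_le_phi (h : NetworkAssumption 𝒢 A γ B) (hγ : γ ∈ Set.Ioo (0 : ℝ) 1)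
    (t : ℕ) (i : Fin n) : γ ^ (n * B) ≤ phi A t i := by
  rcases le_total (n * B) t with ht | ht
  · obtain ⟨k, rfl⟩ := Nat.exists_eq_add_of_le' ht
    have hpos : ∀ s j, 0 ≤ phi A s j := by
      intro s
      induction s with
      | zero => intro j; simp [phi]
      | succ s ih =>
        intro j
        exact Finset.sum_nonneg fun l _ => mul_nonneg (h.weight_nonneg _ _ _) (ih l)
    rw [phi_add]
    calc γ ^ (n * B) ≤ γ ^ (n * B) * n := by
          refine le_mul_of_one_le_right (pow_nonneg hγ.1.le _) ?_
          exact_mod_cast i.pos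
      _ = ∑ j, γ ^ (n * B) * phi A k j := by rw [← Finset.mul_sum, sum_phi h]
      _ ≤ _ := Finset.sum_le_sum fun j _ =>
          mul_le_mul_of_nonneg_right (pow_le_weightProd h hγ.1.le k i j) (hpos k j)
  · have h0 : γ ^ 0 ≤ weightProd A 0 0 i i := by simp [weightProd]
    have h1 := pow_le_weightProd_add h hγ.1.le h0 t
    simp only [zero_add] at h1
    have h2 := phi_add A 0 t i
    rw [zero_add] at h2
    rw [h2]
    simp only [phi, mul_one]
    calc γ ^ (n * B) ≤ γ ^ t := pow_le_pow_of_le_one hγ.1.le hγ.2.le ht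
      _ ≤ _ := h1
      _ ≤ _ := Finset.single_le_sum (f := fun j => weightProd A 0 t i j)
          (fun j _ => weightProd_nonneg h.weight_nonneg _ _ _ _) (Finset.mem_univ i)

/-! ### Convergence of the products of the mixing matrices -/

theorem transition_succ' (A : ℕ → Matrix (Fin n) (Fin n) ℝ) (t k : ℕ) :
    transition A t (k + 1) = transition A (t + 1) k * mixing A t := by
  induction k with
  | zero => simp [transition]
  | succ k ih =>
    rw [transition, ih, transition, Matrix.mul_assoc]
    congr 2
    ring

theorem transition_add (A : ℕ → Matrix (Fin n) (Fin n) ℝ) (t k p : ℕ) :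
    transition A t (k + p) = transition A (t + k) p * transition A t k := by
  induction p with
  | zero => simp [transition]
  | succ p ih =>
    rw [← add_assoc, transition, ih, transition, Matrix.mul_assoc, add_assoc]

theorem mixing_nonneg (hA : ∀ t i j, 0 ≤ A t i j) (hφ : ∀ t i, 0 < phi A t i) (t : ℕ)
    (i j : Fin n) : 0 ≤ mixing A t i j := by
  simp only [mixing, Matrix.of_apply]
  have := hA t i j
  have := hφ t j
  have := hφ (t + 1) i
  positivity

theorem sum_mixing (hφ : ∀ t i, 0 < phi A t i) (t : ℕ) (i : Fin n) : ∑ j, mixing A t i j = 1 := by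
  simp only [mixing, Matrix.of_apply, mul_assoc, ← Finset.mul_sum]
  rw [one_div]
  exact inv_mul_cancel₀ (hφ (t + 1) i).ne'

theorem sum_transition (hφ : ∀ t i, 0 < phi A t i) (t k : ℕ) (i : Fin n) :
    ∑ j, transition A t k i j = 1 := by
  induction k generalizing i with
  | zero => simp [transition, Matrix.one_apply]
  | succ k ih =>
    simp only [transition, Matrix.mul_apply]
    rw [Finset.sum_comm]
    simp only [← Finset.mul_sum, ih, mul_one, sum_mixing hφ]

theorem transition_nonneg (hA : ∀ t i j, 0 ≤ A t i j) (hφ : ∀ t i, 0 < phi A t i) (t k : ℕ)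
    (i j : Fin n) : 0 ≤ transition A t k i j := by
  rw [transition_apply fun t i => (hφ t i).ne']
  exact div_nonneg (mul_nonneg (weightProd_nonneg hA _ _ _ _) (hφ _ _).le) (hφ _ _).le

/-- Averaging with weights that are all at least `δ` contracts an interval by the factor `1 - δ`. -/
theorem sum_mul_mem_Icc_of_le {q v : Fin n → ℝ} {δ a b : ℝ} (hq : ∀ j, δ ≤ q j) (hδ : 0 ≤ δ)
    (hsum : ∑ j, q j = 1) (hv : ∀ j, v j ∈ Set.Icc a b) (p : Fin n) :
    ∑ j, q j * v j ∈ Set.Icc (a + δ * (v p - a)) (b - δ * (b - v p)) := by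
  constructor
  · have h1 : δ * (v p - a) ≤ ∑ j, q j * (v j - a) :=
      calc δ * (v p - a) ≤ q p * (v p - a) :=
            mul_le_mul_of_nonneg_right (hq p) (sub_nonneg.2 (hv p).1)
        _ ≤ _ := Finset.single_le_sum (f := fun j => q j * (v j - a))
            (fun j _ => mul_nonneg (hδ.trans (hq j)) (sub_nonneg.2 (hv j).1)) (Finset.mem_univ p)
    simp only [mul_sub, Finset.sum_sub_distrib, ← Finset.sum_mul, hsum] at h1
    linarith
  · have h1 : δ * (b - v p) ≤ ∑ j, q j * (b - v j) :=
      calc δ * (b - v p) ≤ q p * (b - v p) :=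
            mul_le_mul_of_nonneg_right (hq p) (sub_nonneg.2 (hv p).2)
        _ ≤ _ := Finset.single_le_sum (f := fun j => q j * (b - v j))
            (fun j _ => mul_nonneg (hδ.trans (hq j)) (sub_nonneg.2 (hv j).2)) (Finset.mem_univ p)
    simp only [mul_sub, Finset.sum_sub_distrib, ← Finset.sum_mul, hsum] at h1
    linarith

/-- The entries of a column of the products `ℬ(t+kM : t)` lie in an interval of length
`(1 - δ) ^ k`, if all entries of the products of `M` factors are at least `δ`. -/
theorem exists_Icc_transition (hφ : ∀ t i, 0 < phi A t i) (hn : 0 < n)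
    {δ : ℝ} {M : ℕ} (hδ : 0 ≤ δ) (hM : ∀ t i j, δ ≤ transition A t M i j) (t k : ℕ) (j : Fin n) :
    ∃ a b, b - a ≤ (1 - δ) ^ k ∧ ∀ i, transition A t (k * M) i j ∈ Set.Icc a b := by
  have hδ1 : δ ≤ 1 := by
    have i : Fin n := ⟨0, hn⟩
    calc δ ≤ transition A t M i i := hM _ _ _
      _ ≤ ∑ l, transition A t M i l := Finset.single_le_sum
          (f := fun l => transition A t M i l)
          (fun l _ => hδ.trans (hM _ _ _)) (Finset.mem_univ i)
      _ = 1 := sum_transition hφ _ _ _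
  induction k with
  | zero =>
    refine ⟨0, 1, by simp, fun i => ?_⟩
    by_cases hij : i = j <;> simp [transition, hij]
  | succ k ih =>
    obtain ⟨a, b, hab, hmem⟩ := ih
    set p : Fin n := ⟨0, hn⟩
    set v := fun i => transition A t (k * M) i j with hv
    refine ⟨a + δ * (v p - a), b - δ * (b - v p), ?_, fun i => ?_⟩
    · have : (1 - δ) * (b - a) ≤ (1 - δ) * (1 - δ) ^ k :=
        mul_le_mul_of_nonneg_left hab (by linarith)
      rw [pow_succ']
      linarith
    · rw [add_mul, one_mul, transition_add, Matrix.mul_apply]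
      exact sum_mul_mem_Icc_of_le (fun l => hM _ i l) hδ (sum_transition hφ _ _ _) hmem p

theorem transition_add_mem_Icc (hφ : ∀ t i, 0 < phi A t i) (hA : ∀ t i j, 0 ≤ A t i j)
    {t k : ℕ} {j : Fin n} {a b : ℝ} (hab : ∀ i, transition A t k i j ∈ Set.Icc a b) (p : ℕ)
    (i : Fin n) : transition A t (k + p) i j ∈ Set.Icc a b := by
  have := sum_mul_mem_Icc_of_le (fun l => transition_nonneg hA hφ (t + k) p i l) le_rfl
    (sum_transition hφ _ _ _) hab i
  rw [transition_add, Matrix.mul_apply]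
  simpa using this

theorem pow_div_le_transition (h : NetworkAssumption 𝒢 A γ B) (hγ : γ ∈ Set.Ioo (0 : ℝ) 1)
    (t : ℕ) (i j : Fin n) :
    γ ^ (n * B) * γ ^ (n * B) / n ≤ transition A t (n * B) i j := by
  have hφ : ∀ t i, 0 < phi A t i := fun t i => (pow_pos hγ.1 _).trans_le (pow_le_phi h hγ t i)
  have hle : phi A (t + n * B) i ≤ n := by
    rw [← sum_phi h (t + n * B)]
    exact Finset.single_le_sum (f := fun j => phi A (t + n * B) j) (fun j _ => (hφ _ j).le)
      (Finset.mem_univ i)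
  rw [transition_apply fun t i => (hφ t i).ne']
  exact div_le_div₀ (mul_nonneg (weightProd_nonneg h.weight_nonneg _ _ _ _) (hφ _ _).le)
    (mul_le_mul (pow_le_weightProd h hγ.1.le _ _ _) (pow_le_phi h hγ _ _)
      (pow_nonneg hγ.1.le _) (weightProd_nonneg h.weight_nonneg _ _ _ _)) (hφ _ _) hle

/-- The ranges of a column are nested and shrink to a point, which defines `π t j`. The rate is the
`M`-th root of the contraction per block, and the constant `(1 - δ)⁻¹` makes up for an incomplete
last block. -/
theorem exists_mixingData (hφ : ∀ t i, 0 < phi A t i) (hA : ∀ t i j, 0 ≤ A t i j) (hn : 0 < n)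
    {δ : ℝ} {M : ℕ} (hM0 : 0 < M) (hδ : δ ∈ Set.Ioo (0 : ℝ) 1)
    (hM : ∀ t i j, δ ≤ transition A t M i j) {θ : ℝ} (hθ : ∀ t i, θ⁻¹ ≤ phi A t i) :
    ∃ π : ℕ → Fin n → ℝ, MixingData A π (1 - δ)⁻¹ ((1 - δ) ^ (M : ℝ)⁻¹) θ := by
  set lam : ℝ := (1 - δ) ^ (M : ℝ)⁻¹ with hlam
  have h1δ : 0 < 1 - δ := by linarith [hδ.2]
  have hlamM : lam ^ M = 1 - δ := Real.rpow_inv_natCast_pow h1δ.le hM0.ne'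
  have hlam0 : 0 ≤ lam := Real.rpow_nonneg h1δ.le _
  have hlam1 : lam < 1 := Real.rpow_lt_one h1δ.le (by linarith [hδ.1]) (by positivity)
  -- The interval also holds all later products, hence their limit; this gives the Cauchy property,
  -- independence of the row and the rate.
  have key : ∀ t k j, ∃ a b, b - a ≤ (1 - δ)⁻¹ * lam ^ k ∧
      ∀ p i, transition A t (k + p) i j ∈ Set.Icc a b := by
    intro t k j
    obtain ⟨a, b, hab, hmem⟩ := exists_Icc_transition hφ hn hδ.1.le hM t (k / M) j
    refine ⟨a, b, hab.trans ?_, fun p i => ?_⟩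
    · rw [← hlamM, ← pow_mul, le_inv_mul_iff₀ (pow_pos (by
        exact Real.rpow_pos_of_pos h1δ _) _), ← pow_add]
      refine pow_le_pow_of_le_one hlam0 hlam1.le ?_
      have := Nat.lt_div_mul_add hM0 (a := k)
      rw [mul_comm M]
      omega
    · have hk : k + p = k / M * M + (k % M + p) := by
        have := Nat.div_add_mod' k M
        omega
      rw [hk]
      exact transition_add_mem_Icc hφ hA hmem _ i
  have hlim : ∀ t j, ∃ a, ∀ i, Filter.Tendsto (fun k => transition A t k i j) Filter.atTop
      (nhds a) := by
    intro t j
    have hcauchy : CauchySeq fun k => transition A t k ⟨0, hn⟩ j := by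
      refine cauchySeq_of_le_geometric lam (1 - δ)⁻¹ hlam1 fun k => ?_
      obtain ⟨a, b, hab, hmem⟩ := key t k j
      exact (Real.dist_le_of_mem_Icc (hmem 0 _) (hmem 1 _)).trans hab
    obtain ⟨a, ha⟩ := cauchySeq_tendsto_of_complete hcauchy
    refine ⟨a, fun i => ?_⟩
    refine ha.congr_dist ?_
    refine squeeze_zero (fun _ => dist_nonneg) (fun k => ?_)
      (g := fun k => (1 - δ)⁻¹ * lam ^ k) ?_
    · obtain ⟨a, b, hab, hmem⟩ := key t k j
      exact (Real.dist_le_of_mem_Icc (hmem 0 _) (hmem 0 _)).trans hab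
    · simpa using (tendsto_pow_atTop_nhds_zero_of_lt_one hlam0 hlam1).const_mul (1 - δ)⁻¹
  choose π hπ using hlim
  have hπmem : ∀ t k j a b, (∀ p i, transition A t (k + p) i j ∈ Set.Icc a b) →
      π t j ∈ Set.Icc a b := fun t k j a b hab =>
    isClosed_Icc.mem_of_tendsto ((hπ t j ⟨0, hn⟩).comp (Filter.tendsto_add_atTop_nat k))
      (Filter.Eventually.of_forall fun p => by
        simpa [add_comm] using hab p ⟨0, hn⟩)
  refine ⟨π, ⟨fun t => ?_, fun t k i j => ?_, ⟨δ, hδ.1, fun t j => ?_⟩, fun t => ?_, hθ⟩⟩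
  · refine tendsto_nhds_unique (tendsto_finsetSum _ fun j _ => hπ t j ⟨0, hn⟩) ?_
    simp only [sum_transition hφ]
    exact tendsto_const_nhds
  · obtain ⟨a, b, hab, hmem⟩ := key t k j
    exact (Real.dist_le_of_mem_Icc (hmem 0 i) (hπmem t k j a b hmem)).trans hab
  -- After one block the column lies in `[δ, 1]` and stays there, so `δ` bounds the limit below.
  · refine (hπmem t M j δ 1 fun p i => transition_add_mem_Icc hφ hA (fun l => ⟨hM t l j, ?_⟩) p i).1
    rw [← sum_transition hφ t M l]
    exact Finset.single_le_sum (f := fun j => transition A t M l j)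
      (fun j _ => transition_nonneg hA hφ _ _ _ _) (Finset.mem_univ j)
  · funext j
    have h1 := (hπ t j ⟨0, hn⟩).comp (Filter.tendsto_add_atTop_nat 1)
    refine tendsto_nhds_unique h1 ?_
    simp only [Function.comp_def, transition_succ', Matrix.mul_apply, Matrix.vecMul, dotProduct]
    exact tendsto_finsetSum _ fun l _ => (hπ (t + 1) l ⟨0, hn⟩).mul_const _

theorem exists_mixing_constants (hn : 0 < n) (hγ : γ ∈ Set.Ioo (0 : ℝ) 1) (hB : 0 < B) :
    ∃ C > (0 : ℝ), ∃ lam ∈ Set.Ioo (0 : ℝ) 1, ∃ θ > (0 : ℝ),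
      ∀ (𝒢 : ℕ → Digraph (Fin n)) (A : ℕ → Matrix (Fin n) (Fin n) ℝ),
        NetworkAssumption 𝒢 A γ B → ∃ π : ℕ → Fin n → ℝ, MixingData A π C lam θ := by
  have hM : 0 < n * B := Nat.mul_pos hn hB
  have hpos : 0 < γ ^ (n * B) := pow_pos hγ.1 _
  have hlt : γ ^ (n * B) < 1 := pow_lt_one₀ hγ.1.le hγ.2 hM.ne'
  have hn' : (1 : ℝ) ≤ n := by exact_mod_cast hn
  set δ : ℝ := γ ^ (n * B) * γ ^ (n * B) / n with hδdef
  have hδ : δ ∈ Set.Ioo (0 : ℝ) 1 := by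
    refine ⟨by positivity, ?_⟩
    rw [hδdef, div_lt_one (by linarith)]
    nlinarith
  have h1δ : 0 < 1 - δ := by linarith [hδ.2]
  refine ⟨(1 - δ)⁻¹, inv_pos.2 h1δ, (1 - δ) ^ ((n * B : ℕ) : ℝ)⁻¹,
    ⟨Real.rpow_pos_of_pos h1δ _, Real.rpow_lt_one h1δ.le (by linarith [hδ.1]) (by positivity)⟩,
    (γ ^ (n * B))⁻¹, inv_pos.2 hpos, fun 𝒢 A h => ?_⟩
  exact exists_mixingData (fun t i => hpos.trans_le (pow_le_phi h hγ t i)) h.weight_nonneg hn hM hδ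
    (pow_div_le_transition h hγ) fun t i => by
      rw [inv_inv]
      exact pow_le_phi h hγ t i

end Network

/-! ### The uniform distribution on the sphere and the two-point oracle -/

section Sphere

variable {m : ℕ}

theorem toSphere_univ_ne_zero (hm : 0 < m) :
    (volume : Measure (Vec m)).toSphere Set.univ ≠ 0 := by
  have : Nonempty (Fin m) := ⟨⟨0, hm⟩⟩
  exact Measure.measure_univ_ne_zero.2 (Measure.toSphere_ne_zero _)

theorem isProbabilityMeasure_uniformSphere (hm : 0 < m) :
    IsProbabilityMeasure (uniformSphere m) := by
  constructor
  rw [uniformSphere, Measure.smul_apply, smul_eq_mul]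
  exact ENNReal.inv_mul_cancel (toSphere_univ_ne_zero hm) (measure_ne_top _ _)

theorem integral_toSphere (hm : 0 < m) (φ : UnitSphere m → ℝ) :
    ∫ ζ, φ ζ ∂(volume : Measure (Vec m)).toSphere =
      (volume : Measure (Vec m)).toSphere.real Set.univ * ∫ ζ, φ ζ ∂uniformSphere m := by
  rw [uniformSphere, integral_smul_measure, smul_eq_mul, ← mul_assoc, ENNReal.toReal_inv,
    measureReal_def, mul_inv_cancel₀, one_mul]
  exact ENNReal.toReal_ne_zero.2 ⟨toSphere_univ_ne_zero hm, measure_ne_top _ _⟩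

/-- Polar coordinates, for the product of a function of the norm and a function of the
direction. -/
theorem integral_norm_mul_direction (hm : 0 < m) (h : ℝ → ℝ) (φ : Vec m → ℝ) :
    ∫ x : Vec m, h ‖x‖ * φ (‖x‖⁻¹ • x) = (∫ x : Vec m, h ‖x‖) * ∫ ζ, φ ζ ∂uniformSphere m := by
  have : Nonempty (Fin m) := ⟨⟨0, hm⟩⟩
  have key : ∀ ψ : Vec m → ℝ, ∫ x : Vec m, h ‖x‖ * ψ (‖x‖⁻¹ • x) =
      (∫ ζ, ψ ζ ∂(volume : Measure (Vec m)).toSphere) *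
        ∫ ρ, h ρ ∂Measure.volumeIoiPow (Module.finrank ℝ (Vec m) - 1) := by
    intro ψ
    calc ∫ x : Vec m, h ‖x‖ * ψ (‖x‖⁻¹ • x)
        = ∫ x : ({(0)}ᶜ : Set (Vec m)), h ‖x.1‖ * ψ (‖x.1‖⁻¹ • x.1)
            ∂((volume : Measure (Vec m)).comap (↑)) := by
          rw [integral_subtype_comap (measurableSet_singleton _).compl
            fun x : Vec m ↦ h ‖x‖ * ψ (‖x‖⁻¹ • x), restrict_compl_singleton]
      _ = ∫ x, ψ x.1 * h x.2 ∂((volume : Measure (Vec m)).toSphere.prod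
            (.volumeIoiPow (Module.finrank ℝ (Vec m) - 1))) := by
          rw [← (volume : Measure (Vec m)).measurePreserving_homeomorphUnitSphereProd.integral_comp
            (Homeomorph.measurableEmbedding _)]
          simp [mul_comm]
      _ = _ := integral_prod_mul (fun ζ : UnitSphere m => ψ ζ) fun ρ : Set.Ioi (0 : ℝ) => h ρ
  have h1 := key fun _ => 1
  simp only [mul_one] at h1
  rw [key φ, h1, integral_toSphere hm, integral_toSphere hm]
  have := isProbabilityMeasure_uniformSphere hm
  simp
  ring

/-! ### Balls, cones and integration by parts -/

/-- The indicator function of `(-∞, ρ)`. -/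
noncomputable def below (ρ r : ℝ) : ℝ := (Set.Iio ρ).indicator 1 r

theorem below_of_lt {ρ r : ℝ} (h : r < ρ) : below ρ r = 1 := by
  simp [below, Set.indicator, h]

theorem below_of_le {ρ r : ℝ} (h : ρ ≤ r) : below ρ r = 0 := by
  simp [below, Set.indicator, h]

theorem below_mem_Icc (ρ r : ℝ) : below ρ r ∈ Set.Icc (0 : ℝ) 1 := by
  rcases lt_or_ge r ρ with h | h
  · simp [below_of_lt h]
  · simp [below_of_le h]

@[fun_prop]
theorem measurable_below (ρ : ℝ) : Measurable (below ρ) :=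
  measurable_one.indicator measurableSet_Iio

theorem integral_below_norm {ρ : ℝ} (hρ : 0 ≤ ρ) (hm : 0 < m) :
    ∫ x : Vec m, below ρ ‖x‖ = ρ ^ m * (volume : Measure (Vec m)).real (Metric.ball 0 1) := by
  have : Nonempty (Fin m) := ⟨⟨0, hm⟩⟩
  have h1 : (fun x : Vec m => below ρ ‖x‖) = (Metric.ball (0 : Vec m) ρ).indicator 1 := by
    funext x
    simp [below, Set.indicator]
  rw [h1, integral_indicator_one Metric.isOpen_ball.measurableSet, measureReal_def,
    Measure.addHaar_ball _ _ hρ, ENNReal.toReal_mul, ENNReal.toReal_ofReal (by positivity),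
    finrank_euclideanSpace, Fintype.card_fin, measureReal_def]

theorem integrable_of_bounded_of_support {F : Vec m → ℝ} (hF : Measurable F) {ρ c : ℝ}
    (hc : ∀ x, ‖x‖ < ρ → |F x| ≤ c) (h0 : ∀ x, ρ ≤ ‖x‖ → F x = 0) : Integrable F := by
  have hs : Function.support F ⊆ Metric.ball 0 ρ := by
    intro x hx
    by_contra h
    exact hx (h0 x (by simpa using h))
  rw [← integrableOn_iff_integrable_of_support_subset hs]
  refine Measure.integrableOn_of_bounded (M := c) measure_ball_lt_top.ne
    hF.aestronglyMeasurable ?_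
  filter_upwards [ae_restrict_mem Metric.isOpen_ball.measurableSet] with x hx
  exact hc x (by simpa using hx)

theorem hasDerivAt_norm_add_smul {x : Vec m} (hx : x ≠ 0) (v : Vec m) :
    HasDerivAt (fun t : ℝ => ‖x + t • v‖) (inner ℝ (‖x‖⁻¹ • x) v) 0 := by
  have h1 : HasDerivAt (fun t : ℝ => x + t • v) v 0 := by
    simpa using ((hasDerivAt_id (0 : ℝ)).smul_const v).const_add x
  have h2 := h1.norm_sq.sqrt (by simpa using hx)
  simp only [Real.sqrt_sq (norm_nonneg _), zero_smul, add_zero] at h2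
  convert h2 using 1
  rw [real_inner_smul_left]
  field_simp

/-- The direction is `-u` because integration by parts moves the derivative to the other factor with
reversed direction. -/
theorem lineDeriv_cone {ρ : ℝ} {x : Vec m} (hx : x ≠ 0) (hρ : ‖x‖ ≠ ρ) (u : Vec m) :
    lineDeriv ℝ (fun x : Vec m => max (ρ - ‖x‖) 0) x (-u) =
      below ρ ‖x‖ * inner ℝ (‖x‖⁻¹ • x) u := by
  refine HasLineDerivAt.lineDeriv ?_
  have hcont : Continuous fun t : ℝ => ‖x + t • (-u)‖ := by fun_prop
  rcases lt_or_gt_of_ne hρ with h | h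
  · have hev : ∀ᶠ t : ℝ in nhds 0, ‖x + t • (-u)‖ < ρ :=
      hcont.continuousAt.eventually_lt continuousAt_const (by simpa using h)
    have h1 := (hasDerivAt_norm_add_smul hx (-u)).const_sub ρ
    rw [inner_neg_right, neg_neg] at h1
    rw [below_of_lt h, one_mul]
    refine h1.congr_of_eventuallyEq ?_
    filter_upwards [hev] with t ht
    exact max_eq_left (by linarith)
  · have hev : ∀ᶠ t : ℝ in nhds 0, ρ < ‖x + t • (-u)‖ :=
      continuousAt_const.eventually_lt hcont.continuousAt (by simpa using h)
    rw [below_of_le h.le, zero_mul]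
    refine (hasDerivAt_const (0 : ℝ) (0 : ℝ)).congr_of_eventuallyEq ?_
    filter_upwards [hev] with t ht
    exact max_eq_right (by linarith)

theorem lipschitzWith_cone (ρ : ℝ) : LipschitzWith 1 fun x : Vec m => max (ρ - ‖x‖) 0 := by
  have h1 : LipschitzWith 1 fun x : Vec m => ρ - ‖x‖ := by
    refine LipschitzWith.of_dist_le_mul fun x y => ?_
    rw [NNReal.coe_one, one_mul, dist_sub_left, Real.dist_eq, dist_eq_norm]
    exact abs_norm_sub_norm_le x y
  exact h1.max_const 0

theorem hasCompactSupport_cone (ρ : ℝ) :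
    HasCompactSupport fun x : Vec m => max (ρ - ‖x‖) 0 := by
  refine HasCompactSupport.intro (isCompact_closedBall (0 : Vec m) ρ) fun x hx => ?_
  simp only [Metric.mem_closedBall, dist_zero_right, not_le] at hx
  exact max_eq_right (by linarith)

/-- Integration by parts against the cone of radius `ρ`. -/
theorem integral_lineDeriv_mul_cone (hm : 0 < m) {f : Vec m → ℝ} {G : NNReal}
    (hf : LipschitzWith G f) {ρ : ℝ} (u : Vec m) :
    ∫ x, lineDeriv ℝ f x u * max (ρ - ‖x‖) 0 =
      ∫ x, below ρ ‖x‖ * inner ℝ (‖x‖⁻¹ • x) u * f x := by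
  have : Nonempty (Fin m) := ⟨⟨0, hm⟩⟩
  rw [hf.integral_lineDeriv_mul_eq (lipschitzWith_cone ρ) (hasCompactSupport_cone ρ) u]
  refine integral_congr_ae ?_
  have h1 : ∀ᵐ x : Vec m, x ≠ 0 := by
    simp [ae_iff]
  have h2 : ∀ᵐ x : Vec m, ‖x‖ ≠ ρ := by
    have := Measure.addHaar_sphere (volume : Measure (Vec m)) 0 ρ
    rw [ae_iff]
    convert this using 2
    ext x
    simp
  filter_upwards [h1, h2] with x hx0 hxρ
  rw [lineDeriv_cone hx0 hxρ]

theorem abs_inner_direction_le (x u : Vec m) : |inner ℝ (‖x‖⁻¹ • x) u| ≤ ‖u‖ := by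
  refine (abs_real_inner_le_norm _ _).trans ?_
  refine mul_le_of_le_one_left (norm_nonneg u) ?_
  rw [norm_smul, norm_inv, norm_norm]
  exact inv_mul_le_one

/-- Over a thin shell, the mean of `⟨x / ‖x‖, u⟩ f x` is close to the mean over the sphere. -/
theorem integral_shell_le (hm : 0 < m) {f : Vec m → ℝ} {G : NNReal} (hf : LipschitzWith G f)
    {μ ε : ℝ} (hε : 0 < ε) (hεμ : ε < μ) (u : Vec m) :
    ∫ x, (below μ ‖x‖ - below (μ - ε) ‖x‖) * (inner ℝ (‖x‖⁻¹ • x) u * f x) ≤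
      (∫ x : Vec m, (below μ ‖x‖ - below (μ - ε) ‖x‖)) *
        ((∫ ζ, inner ℝ (ζ : Vec m) u * f (μ • (ζ : Vec m)) ∂uniformSphere m) + ‖u‖ * G * ε) := by
  have hμ : 0 < μ := hε.trans hεμ
  set h : ℝ → ℝ := fun r => below μ r - below (μ - ε) r with hh
  have hmeas : Measurable h := by fun_prop
  have h0 : ∀ r, 0 ≤ h r := by
    intro r
    rcases lt_or_ge r μ with hr | hr
    · simp only [hh, below_of_lt hr]
      linarith [(below_mem_Icc (μ - ε) r).2]
    · simp [hh, below_of_le hr, below_of_le (show μ - ε ≤ r by linarith)]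
  have h1 : ∀ r, h r ≤ 1 := fun r => by
    have := (below_mem_Icc μ r).2
    have := (below_mem_Icc (μ - ε) r).1
    simp only [hh]
    linarith
  have hout : ∀ r, μ ≤ r → h r = 0 := fun r hr => by
    simp [hh, below_of_le hr, below_of_le (show μ - ε ≤ r by linarith)]
  have hin : ∀ r, r < μ - ε → h r = 0 := fun r hr => by
    simp [hh, below_of_lt hr, below_of_lt (show r < μ by linarith)]
  have hfb : ∀ x, ‖x‖ ≤ μ → |f x| ≤ |f 0| + G * μ := fun x hx => by
    have h2 := hf.dist_le_mul x 0
    rw [Real.dist_eq, dist_zero_right] at h2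
    have h3 := abs_sub_abs_le_abs_sub (f x) (f 0)
    have h4 : (G : ℝ) * ‖x‖ ≤ G * μ := mul_le_mul_of_nonneg_left hx G.2
    linarith
  have hdir : ∀ x : Vec m, ‖μ • (‖x‖⁻¹ • x)‖ ≤ μ := fun x => by
    rw [norm_smul, norm_smul, norm_inv, norm_norm, Real.norm_of_nonneg hμ.le]
    exact mul_le_of_le_one_right hμ.le inv_mul_le_one
  have hbd : ∀ x y : Vec m, ‖y‖ ≤ μ →
      |h ‖x‖ * (inner ℝ (‖x‖⁻¹ • x) u * f y)| ≤ ‖u‖ * (|f 0| + G * μ) := fun x y hy => by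
    rw [abs_mul, abs_mul, abs_of_nonneg (h0 _)]
    calc h ‖x‖ * (|inner ℝ (‖x‖⁻¹ • x) u| * |f y|)
        ≤ 1 * (‖u‖ * (|f 0| + G * μ)) := mul_le_mul (h1 _)
          (mul_le_mul (abs_inner_direction_le x u) (hfb y hy) (abs_nonneg _) (norm_nonneg _))
          (by positivity) zero_le_one
      _ = _ := one_mul _
  have hfm : Measurable f := hf.continuous.measurable
  have i1 : Integrable fun x : Vec m => h ‖x‖ * (inner ℝ (‖x‖⁻¹ • x) u * f x) :=
    integrable_of_bounded_of_support (ρ := μ) (by fun_prop) (fun x hx => hbd x x hx.le)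
      fun x hx => by rw [hout _ hx, zero_mul]
  have i2 : Integrable fun x : Vec m =>
      h ‖x‖ * (inner ℝ (‖x‖⁻¹ • x) u * f (μ • (‖x‖⁻¹ • x))) :=
    integrable_of_bounded_of_support (ρ := μ) (by fun_prop) (fun x _ => hbd x _ (hdir x))
      fun x hx => by rw [hout _ hx, zero_mul]
  have i3 : Integrable fun x : Vec m => h ‖x‖ * (‖u‖ * G * ε) :=
    (integrable_of_bounded_of_support (ρ := μ) (c := 1) (by fun_prop)
      (fun x _ => by rw [abs_of_nonneg (h0 _)]; exact h1 _) fun x hx => hout _ hx).mul_const _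
  -- On the shell, `x` is within `ε` of the point of the sphere of radius `μ` in its direction.
  -- Moving `f` there costs `G * ε` and leaves a function of the norm times a function of the
  -- direction.
  calc ∫ x, h ‖x‖ * (inner ℝ (‖x‖⁻¹ • x) u * f x)
      ≤ ∫ x, (h ‖x‖ * (inner ℝ (‖x‖⁻¹ • x) u * f (μ • (‖x‖⁻¹ • x))) + h ‖x‖ * (‖u‖ * G * ε)) := by
        refine integral_mono i1 (i2.add i3) fun x => ?_
        simp only
        rw [← mul_add]
        rcases lt_or_ge ‖x‖ (μ - ε) with hx | hx
        · rw [hin _ hx, zero_mul, zero_mul]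
        rcases lt_or_ge ‖x‖ μ with hx' | hx'
        · refine mul_le_mul_of_nonneg_left ?_ (h0 _)
          have hxpos : 0 < ‖x‖ := by linarith
          have hdist : ‖x - μ • (‖x‖⁻¹ • x)‖ ≤ ε := by
            have : x - μ • (‖x‖⁻¹ • x) = (‖x‖ - μ) • (‖x‖⁻¹ • x) := by
              rw [sub_smul, smul_inv_smul₀ hxpos.ne']
            rw [this, norm_smul, norm_smul, norm_inv, norm_norm, inv_mul_cancel₀ hxpos.ne',
              mul_one, Real.norm_eq_abs, abs_le]
            constructor <;> linarith
          have hd := hf.dist_le_mul x (μ • (‖x‖⁻¹ • x))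
          rw [Real.dist_eq, dist_eq_norm] at hd
          have hd' : |f x - f (μ • (‖x‖⁻¹ • x))| ≤ G * ε :=
            hd.trans (mul_le_mul_of_nonneg_left hdist G.2)
          have h3 : inner ℝ (‖x‖⁻¹ • x) u * (f x - f (μ • (‖x‖⁻¹ • x))) ≤ ‖u‖ * (G * ε) := by
            refine (le_abs_self _).trans ?_
            rw [abs_mul]
            exact mul_le_mul (abs_inner_direction_le x u) hd' (abs_nonneg _) (norm_nonneg _)
          linarith
        · rw [hout _ hx', zero_mul, zero_mul]
    _ = _ := by
        rw [integral_add i2 i3, integral_mul_const, mul_add]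
        rw [integral_norm_mul_direction hm h fun z => inner ℝ z u * f (μ • z)]

/-- Slopes are taken from the left because convexity is available on the segment from `x - u` to
`x`, not beyond `x`. -/
theorem sub_le_lineDeriv_of_convexOn {K : Set (Vec m)} {f : Vec m → ℝ} (hf : ConvexOn ℝ K f)
    {x u : Vec m} (hx : x ∈ K) (hxu : x - u ∈ K) (hd : LineDifferentiableAt ℝ f x u) :
    f x - f (x - u) ≤ lineDeriv ℝ f x u := by
  have ht := hd.hasLineDerivAt.tendsto_slope_zero_left
  refine ge_of_tendsto ht ?_
  have hev : ∀ᶠ t : ℝ in nhdsWithin 0 (Set.Iio 0), t ∈ Set.Ioo (-1 : ℝ) 0 :=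
    Ioo_mem_nhdsLT (by norm_num)
  filter_upwards [hev] with t ht
  have h1 := hf.2 hx hxu (by linarith [ht.1] : 0 ≤ 1 + t) (by linarith [ht.2] : 0 ≤ -t) (by ring)
  have h2 : (1 + t) • x + (-t) • (x - u) = x + t • u := by
    rw [smul_sub, add_smul, one_smul, neg_smul, neg_smul]
    abel
  rw [h2, smul_eq_mul, smul_eq_mul] at h1
  rw [smul_eq_mul, inv_mul_eq_div, le_div_iff_of_neg ht.2]
  linarith

/-! ### Truncated cones and the mean over the sphere -/

/-- A truncated cone of height `ε`. -/
noncomputable def frustum (μ ε : ℝ) (x : Vec m) : ℝ := max (μ - ‖x‖) 0 - max (μ - ε - ‖x‖) 0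

/-- Divided by `ε`, the frustum is squeezed between the indicators of two balls, so its integral
tends to the volume of the ball of radius `μ`. -/
theorem frustum_mem_Icc {μ ε : ℝ} (hε : 0 < ε) (x : Vec m) :
    frustum μ ε x ∈ Set.Icc (ε * below (μ - ε) ‖x‖) (ε * below μ ‖x‖) := by
  unfold frustum
  rcases lt_or_ge ‖x‖ (μ - ε) with h | h
  · rw [below_of_lt h, below_of_lt (by linarith : ‖x‖ < μ), max_eq_left (by linarith),
      max_eq_left (by linarith)]
    constructor <;> linarith
  · rw [below_of_le h, max_eq_right (by linarith : μ - ε - ‖x‖ ≤ 0)]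
    rcases lt_or_ge ‖x‖ μ with h' | h'
    · rw [below_of_lt h', max_eq_left (by linarith)]
      constructor <;> linarith
    · rw [below_of_le h', max_eq_right (by linarith)]
      constructor <;> linarith

theorem continuous_frustum (μ ε : ℝ) : Continuous (frustum μ ε : Vec m → ℝ) := by
  unfold frustum
  fun_prop

theorem hasCompactSupport_frustum {μ ε : ℝ} (hε : 0 < ε) :
    HasCompactSupport (frustum μ ε : Vec m → ℝ) := by
  refine HasCompactSupport.intro (isCompact_closedBall (0 : Vec m) μ) fun x hx => ?_
  simp only [Metric.mem_closedBall, dist_zero_right, not_le] at hx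
  have := frustum_mem_Icc hε x (μ := μ)
  rw [below_of_le hx.le, below_of_le (by linarith)] at this
  simpa using this

theorem integrable_lineDeriv_mul {f g : Vec m → ℝ} {G : NNReal} (hf : LipschitzWith G f)
    (hg : Integrable g) (u : Vec m) : Integrable fun x => lineDeriv ℝ f x u * g x :=
  hg.bdd_mul (c := G * ‖u‖) (aestronglyMeasurable_lineDeriv hf.continuous _)
    (.of_forall fun _ => norm_lineDeriv_le_of_lipschitz ℝ hf)

/-- The mean of a convex function over a symmetric neighbourhood of `0` is at least its value
at `0`. -/
theorem mul_integral_frustum_le {K : Set (Vec m)} {f : Vec m → ℝ} (hcont : Continuous f)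
    (hconv : ConvexOn ℝ K f) {μ ε : ℝ} (hε : 0 < ε) (h0 : Metric.closedBall 0 μ ⊆ K) :
    f 0 * ∫ x : Vec m, frustum μ ε x ≤ ∫ x, f x * frustum μ ε x := by
  have hc := continuous_frustum (m := m) μ ε
  have hs := hasCompactSupport_frustum (m := m) (μ := μ) hε
  have i0 : Integrable (frustum μ ε : Vec m → ℝ) := hc.integrable_of_hasCompactSupport hs
  have i1 : Integrable fun x => f x * frustum μ ε x :=
    (hcont.mul hc).integrable_of_hasCompactSupport hs.mul_left
  have hneg : ∀ x : Vec m, frustum μ ε (-x) = frustum μ ε x := fun x => by simp [frustum]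
  have i2 : Integrable fun x => f (-x) * frustum μ ε x := by
    simpa [hneg] using i1.comp_neg
  have e1 : ∫ x, f (-x) * frustum μ ε x = ∫ x, f x * frustum μ ε x := by
    rw [← integral_neg_eq_self]
    simp [hneg]
  have e2 : 2 * (f 0 * ∫ x : Vec m, frustum μ ε x) ≤
      (∫ x, f x * frustum μ ε x) + ∫ x, f (-x) * frustum μ ε x := by
    rw [← integral_add i1 i2, ← mul_assoc, ← integral_const_mul]
    refine integral_mono (i0.const_mul _) (i1.add i2) fun x => ?_
    have hfr := frustum_mem_Icc hε x (μ := μ)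
    simp only
    rw [← add_mul]
    rcases lt_or_ge ‖x‖ μ with hx | hx
    · refine mul_le_mul_of_nonneg_right ?_
        ((mul_nonneg hε.le (below_mem_Icc _ _).1).trans hfr.1)
      have h1 := hconv.2 (h0 (by simpa using hx.le : x ∈ Metric.closedBall 0 μ))
        (h0 (by simpa using hx.le : -x ∈ Metric.closedBall 0 μ))
        (by norm_num : (0 : ℝ) ≤ 1 / 2) (by norm_num : (0 : ℝ) ≤ 1 / 2) (by norm_num)
      simp only [smul_neg, add_neg_cancel, smul_eq_mul] at h1
      linarith
    · rw [below_of_le hx, below_of_le (by linarith)] at hfr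
      have : frustum μ ε x = 0 := by simpa using hfr
      rw [this, mul_zero, mul_zero]
  linarith

/-- Almost everywhere the derivative at `x` is at least `f x - f (x - u)`. Replacing `x - u` by `-u`
costs `μ * G`; replacing `x` by `0` is free, by the symmetry of the frustum. Hence the error is `μ *
G` and not `2 * μ * G`. -/
theorem mul_integral_frustum_le_integral_lineDeriv {K : Set (Vec m)} {f : Vec m → ℝ} {G : NNReal}
    (hf : LipschitzWith G f) (hconv : ConvexOn ℝ K f) {μ ε : ℝ} (hε : 0 < ε) {u : Vec m}
    (h0 : Metric.closedBall 0 μ ⊆ K) (hu : Metric.closedBall (-u) μ ⊆ K) :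
    (f 0 - f (-u) - μ * G) * ∫ x : Vec m, frustum μ ε x ≤
      ∫ x, lineDeriv ℝ f x u * frustum μ ε x := by
  have hc := continuous_frustum (m := m) μ ε
  have hs := hasCompactSupport_frustum (m := m) (μ := μ) hε
  have i0 : Integrable (frustum μ ε : Vec m → ℝ) := hc.integrable_of_hasCompactSupport hs
  have i1 : Integrable fun x => f x * frustum μ ε x :=
    (hf.continuous.mul hc).integrable_of_hasCompactSupport hs.mul_left
  have h1 := mul_integral_frustum_le hf.continuous hconv hε h0
  have h2 : ∫ x, (f x * frustum μ ε x - (f (-u) + μ * G) * frustum μ ε x) ≤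
      ∫ x, lineDeriv ℝ f x u * frustum μ ε x := by
    refine integral_mono_ae (i1.sub (i0.const_mul _)) (integrable_lineDeriv_mul hf i0 u) ?_
    filter_upwards [hf.ae_lineDifferentiableAt (μ := volume) u] with x hd
    have hfr := frustum_mem_Icc hε x (μ := μ)
    rw [← sub_mul]
    rcases lt_or_ge ‖x‖ μ with hx | hx
    · refine mul_le_mul_of_nonneg_right ?_
        ((mul_nonneg hε.le (below_mem_Icc _ _).1).trans hfr.1)
      have h3 := sub_le_lineDeriv_of_convexOn hconv
        (h0 (by simpa using hx.le : x ∈ Metric.closedBall 0 μ))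
        (hu (by simpa [dist_eq_norm] using hx.le : x - u ∈ Metric.closedBall (-u) μ)) hd
      have h4 := hf.dist_le_mul (x - u) (-u)
      rw [Real.dist_eq, dist_eq_norm, sub_neg_eq_add, sub_add_cancel] at h4
      have h5 : (G : ℝ) * ‖x‖ ≤ G * μ := mul_le_mul_of_nonneg_left hx.le G.2
      have h6 := le_abs_self (f (x - u) - f (-u))
      linarith
    · rw [below_of_le hx, below_of_le (by linarith)] at hfr
      have : frustum μ ε x = 0 := by simpa using hfr
      rw [this, mul_zero, mul_zero]
  rw [integral_sub i1 (i0.const_mul _), integral_const_mul] at h2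
  linarith

/-- A frustum is a difference of two cones whose gradients cancel on the smaller ball, so only the
shell contributes. -/
theorem integral_lineDeriv_mul_frustum (hm : 0 < m) {f : Vec m → ℝ} {G : NNReal}
    (hf : LipschitzWith G f) {μ ε : ℝ} (u : Vec m) :
    ∫ x, lineDeriv ℝ f x u * frustum μ ε x =
      ∫ x, (below μ ‖x‖ - below (μ - ε) ‖x‖) * (inner ℝ (‖x‖⁻¹ • x) u * f x) := by
  have hcone : ∀ ρ, Integrable fun x : Vec m => max (ρ - ‖x‖) 0 := fun ρ =>
    (lipschitzWith_cone ρ).continuous.integrable_of_hasCompactSupport (hasCompactSupport_cone ρ)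
  have hfm : Measurable f := hf.continuous.measurable
  have hball : ∀ ρ, Integrable fun x : Vec m => below ρ ‖x‖ * inner ℝ (‖x‖⁻¹ • x) u * f x := by
    intro ρ
    refine integrable_of_bounded_of_support (ρ := ρ) (c := 1 * ‖u‖ * (|f 0| + G * ρ)) (by fun_prop)
      (fun x hx => ?_) fun x hx => by rw [below_of_le hx, zero_mul, zero_mul]
    have h2 := hf.dist_le_mul x 0
    rw [Real.dist_eq, dist_zero_right] at h2
    have h3 := abs_sub_abs_le_abs_sub (f x) (f 0)
    have h4 : (G : ℝ) * ‖x‖ ≤ G * ρ := mul_le_mul_of_nonneg_left hx.le G.2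
    rw [abs_mul, abs_mul, below_of_lt hx, abs_one]
    exact mul_le_mul (mul_le_mul_of_nonneg_left (abs_inner_direction_le x u) zero_le_one)
      (by linarith) (abs_nonneg _) (by positivity)
  simp only [frustum, mul_sub, sub_mul, ← mul_assoc]
  rw [integral_sub (integrable_lineDeriv_mul hf (hcone _) u)
    (integrable_lineDeriv_mul hf (hcone _) u), integral_lineDeriv_mul_cone hm hf,
    integral_lineDeriv_mul_cone hm hf, integral_sub (hball _) (hball _)]

theorem integrable_below_norm (ρ : ℝ) : Integrable fun x : Vec m => below ρ ‖x‖ :=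
  integrable_of_bounded_of_support (ρ := ρ) (c := 1) (by fun_prop)
    (fun x _ => by rw [abs_of_nonneg (below_mem_Icc _ _).1]; exact (below_mem_Icc _ _).2)
    fun x hx => below_of_le hx

/-- A weak form of the fact that `x ↦ (m / μ) E[f (x + μ ζ) ζ]` is the gradient of the mean of `f`
over the balls of radius `μ`. -/
theorem sub_le_integral_sphere (hm : 0 < m) {K : Set (Vec m)} {f : Vec m → ℝ} {G : NNReal}
    (hf : LipschitzWith G f) (hconv : ConvexOn ℝ K f) {μ : ℝ} (hμ : 0 < μ) {u : Vec m}
    (h0 : Metric.closedBall 0 μ ⊆ K) (hu : Metric.closedBall (-u) μ ⊆ K) :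
    f 0 - f (-u) - μ * G ≤
      m / μ * ∫ ζ, inner ℝ (ζ : Vec m) u * f (μ • (ζ : Vec m)) ∂uniformSphere m := by
  set c := f 0 - f (-u) - μ * G
  set E := ∫ ζ, inner ℝ (ζ : Vec m) u * f (μ • (ζ : Vec m)) ∂uniformSphere m
  set V := (volume : Measure (Vec m)).real (Metric.ball 0 1)
  have hV : 0 < V := by
    refine ENNReal.toReal_pos (Metric.measure_ball_pos _ _ one_pos).ne' measure_ball_lt_top.ne
  have hev : ∀ᶠ ε : ℝ in nhdsWithin 0 (Set.Ioi 0), ε ∈ Set.Ioo 0 μ := Ioo_mem_nhdsGT hμ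
  -- Both estimates of the same integral, divided by `ε`, with the volume of the shell computed.
  have hineq : ∀ᶠ ε : ℝ in nhdsWithin 0 (Set.Ioi 0),
      c * (ε⁻¹ * ∫ x : Vec m, frustum μ ε x) ≤
        (ε⁻¹ * (μ ^ m - (μ - ε) ^ m)) * V * (E + ‖u‖ * G * ε) := by
    filter_upwards [hev] with ε hε
    have h1 := mul_integral_frustum_le_integral_lineDeriv hf hconv hε.1 h0 hu
    rw [integral_lineDeriv_mul_frustum hm hf] at h1
    have h2 := h1.trans (integral_shell_le hm hf hε.1 hε.2 u)
    rw [integral_sub (integrable_below_norm _) (integrable_below_norm _),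
      integral_below_norm hμ.le hm, integral_below_norm (by linarith [hε.2]) hm] at h2
    have h3 := mul_le_mul_of_nonneg_left h2 (inv_nonneg.2 hε.1.le)
    calc _ = ε⁻¹ * (c * ∫ x : Vec m, frustum μ ε x) := by ring
      _ ≤ _ := h3
      _ = _ := by ring
  have hid : Filter.Tendsto (fun ε : ℝ => ε) (nhdsWithin 0 (Set.Ioi 0)) (nhds 0) :=
    tendsto_nhdsWithin_of_tendsto_nhds Filter.tendsto_id
  have hfr : Filter.Tendsto (fun ε : ℝ => ε⁻¹ * ∫ x : Vec m, frustum μ ε x)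
      (nhdsWithin 0 (Set.Ioi 0)) (nhds (μ ^ m * V)) := by
    have hlow : Filter.Tendsto (fun ε : ℝ => (μ - ε) ^ m * V)
        (nhdsWithin 0 (Set.Ioi 0)) (nhds (μ ^ m * V)) := by
      simpa using ((hid.const_sub μ).pow m).mul_const V
    refine tendsto_of_tendsto_of_tendsto_of_le_of_le' hlow tendsto_const_nhds ?_ ?_
    · filter_upwards [hev] with ε hε
      rw [← integral_below_norm (by linarith [hε.2]) hm, le_inv_mul_iff₀ hε.1,
        ← integral_const_mul]
      exact integral_mono ((integrable_below_norm _).const_mul _)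
        ((continuous_frustum μ ε).integrable_of_hasCompactSupport (hasCompactSupport_frustum hε.1))
        fun x => (frustum_mem_Icc hε.1 x).1
    · filter_upwards [hev] with ε hε
      rw [← integral_below_norm hμ.le hm, inv_mul_le_iff₀ hε.1, ← integral_const_mul]
      exact integral_mono
        ((continuous_frustum μ ε).integrable_of_hasCompactSupport (hasCompactSupport_frustum hε.1))
        ((integrable_below_norm _).const_mul _) fun x => (frustum_mem_Icc hε.1 x).2
  -- Volume of the shell over its thickness: the limit, a derivative of `μ ^ m`, produces the factor
  -- `m` of the oracle.
  have hder : Filter.Tendsto (fun ε : ℝ => ε⁻¹ * (μ ^ m - (μ - ε) ^ m))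
      (nhdsWithin 0 (Set.Ioi 0)) (nhds (m * μ ^ (m - 1))) := by
    have h1 : HasDerivAt (fun ε : ℝ => -(μ - ε) ^ m) (m * μ ^ (m - 1)) 0 := by
      have h3 : HasDerivAt (fun ε : ℝ => μ - ε) (-1) 0 := (hasDerivAt_id (0 : ℝ)).const_sub μ
      have h4 := (h3.fun_pow m).fun_neg
      simpa using h4
    have h2 := h1.tendsto_slope_zero.mono_left (nhdsGT_le_nhdsNE 0)
    refine h2.congr fun ε => ?_
    simp only [zero_add, sub_zero, smul_eq_mul]
    ring
  have hE : Filter.Tendsto (fun ε : ℝ => E + ‖u‖ * G * ε)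
      (nhdsWithin 0 (Set.Ioi 0)) (nhds E) := by
    simpa using (hid.const_mul (‖u‖ * (G : ℝ))).const_add E
  have hfinal := le_of_tendsto_of_tendsto (hfr.const_mul c) ((hder.mul_const V).mul hE) hineq
  -- This removes the truncated subtraction in `μ ^ (m - 1)`, so that `μ ^ k * V` can be cancelled.
  obtain ⟨k, rfl⟩ : ∃ k, m = k + 1 := ⟨m - 1, by omega⟩
  have h4 : c * (μ * (μ ^ k * V)) ≤ ((k + 1 : ℕ) : ℝ) * E * (μ ^ k * V) := by
    rw [Nat.add_sub_cancel, pow_succ] at hfinal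
    calc _ = _ := by ring
      _ ≤ _ := hfinal
      _ = _ := by ring
  rw [← mul_assoc] at h4
  have h5 := le_of_mul_le_mul_right h4 (mul_pos (pow_pos hμ k) hV)
  rw [div_mul_eq_mul_div, le_div_iff₀ hμ]
  exact h5

/-- Apply the bound at the origin to `z ↦ f (x + z) - f x` with `u = x - y`. The subtracted `f x` of
the oracle is built in, so the mean of `ζ` plays no role. -/
theorem sub_le_integral_inner_oracle (hm : 0 < m) {K : Set (Vec m)} {f : Vec m → ℝ} {G : NNReal}
    (hf : LipschitzWith G f) (hconv : ConvexOn ℝ K f) {μ : ℝ} (hμ : 0 < μ) {x y : Vec m}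
    (hx : Metric.closedBall x μ ⊆ K) (hy : Metric.closedBall y μ ⊆ K) :
    f x - f y - μ * G ≤ ∫ ζ, inner ℝ (oracle f μ ζ x) (x - y) ∂uniformSphere m := by
  have hlip : LipschitzWith G fun z => f (x + z) - f x := by
    refine LipschitzWith.of_dist_le_mul fun a b => ?_
    rw [dist_sub_right]
    simpa using hf.dist_le_mul (x + a) (x + b)
  have hcv : ConvexOn ℝ ((fun z => x + z) ⁻¹' K) fun z => f (x + z) - f x := by
    have h := ConvexOn.add_const (hconv.translate_right x) (-f x)
    simp only [sub_eq_add_neg]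
    exact h
  have key := sub_le_integral_sphere hm hlip hcv hμ (u := x - y)
    (fun z hz => hx (by simpa using hz))
    (fun z hz => hy (by
      simp only [Metric.mem_closedBall, dist_eq_norm] at hz ⊢
      convert hz using 2
      abel))
  simp only [add_zero, sub_self, neg_sub, add_sub_cancel] at key
  rw [← integral_const_mul] at key
  refine (le_of_eq ?_).trans (key.trans (le_of_eq ?_))
  · ring
  · refine integral_congr_ae (.of_forall fun ζ => ?_)
    simp only [oracle, real_inner_smul_left]
    ring

end Sphere

/-! ### The Euclidean projection -/

section Projection

variable {m : ℕ} {K : Set (Vec m)}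

theorem proj_spec (hne : K.Nonempty) (hcl : IsClosed K) (y : Vec m) :
    proj K y ∈ K ∧ IsMinOn (fun w => ‖w - y‖ ^ 2) K (proj K y) := by
  refine Classical.epsilon_spec (p := fun z => z ∈ K ∧ IsMinOn (fun w => ‖w - y‖ ^ 2) K z) ?_
  obtain ⟨z, hz, hzy⟩ := hcl.exists_infDist_eq_dist hne y
  refine ⟨z, hz, fun w hw => ?_⟩
  have h1 : dist y z ≤ dist y w := hzy ▸ Metric.infDist_le_dist_of_mem hw
  rw [dist_comm, dist_comm y, dist_eq_norm, dist_eq_norm] at h1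
  exact pow_le_pow_left₀ (norm_nonneg _) h1 2

theorem proj_mem (hne : K.Nonempty) (hcl : IsClosed K) (y : Vec m) : proj K y ∈ K :=
  (proj_spec hne hcl y).1

theorem inner_sub_proj_nonpos (hne : K.Nonempty) (hcl : IsClosed K) (hconv : Convex ℝ K)
    (y : Vec m) {w : Vec m} (hw : w ∈ K) : inner ℝ (y - proj K y) (w - proj K y) ≤ 0 := by
  have hmem := proj_mem hne hcl y
  refine (norm_eq_iInf_iff_real_inner_le_zero hconv hmem).1 ?_ w hw
  have : Nonempty K := ⟨⟨_, hmem⟩⟩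
  refine le_antisymm (le_ciInf fun v => ?_)
    (ciInf_le ⟨0, Set.forall_mem_range.2 fun _ => norm_nonneg _⟩ (⟨_, hmem⟩ : K))
  have h1 := (proj_spec hne hcl y).2 v.2
  simp only [Set.mem_ofPred_eq] at h1
  rw [norm_sub_rev, norm_sub_rev y]
  exact le_of_sq_le_sq h1 (norm_nonneg _)

theorem norm_proj_sub_proj_le (hne : K.Nonempty) (hcl : IsClosed K) (hconv : Convex ℝ K)
    (y z : Vec m) : ‖proj K y - proj K z‖ ≤ ‖y - z‖ := by
  have h1 := inner_sub_proj_nonpos hne hcl hconv y (proj_mem hne hcl z)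
  have h2 := inner_sub_proj_nonpos hne hcl hconv z (proj_mem hne hcl y)
  set p := proj K y
  set q := proj K z
  have h3 : ‖p - q‖ ^ 2 ≤ inner ℝ (y - z) (p - q) := by
    have e1 : inner ℝ (y - p) (q - p) = -inner ℝ (y - p) (p - q) := by
      rw [← inner_neg_right, neg_sub]
    have e2 : inner ℝ (y - z) (p - q) =
        inner ℝ (y - p) (p - q) + inner ℝ (p - q) (p - q) - inner ℝ (z - q) (p - q) := by
      rw [← inner_add_left, ← inner_sub_left]
      congr 1
      abel
    rw [← real_inner_self_eq_norm_sq]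
    linarith
  have h4 := h3.trans (real_inner_le_norm _ _)
  by_contra! h
  nlinarith [norm_nonneg (y - z), norm_nonneg (p - q)]

theorem continuous_proj (hne : K.Nonempty) (hcl : IsClosed K) (hconv : Convex ℝ K) :
    Continuous (proj K) := by
  refine (LipschitzWith.of_dist_le_mul (K := 1) fun y z => ?_).continuous
  rw [dist_eq_norm, dist_eq_norm, NNReal.coe_one, one_mul]
  exact norm_proj_sub_proj_le hne hcl hconv y z

theorem proj_eq_self (hne : K.Nonempty) (hcl : IsClosed K) {y : Vec m} (hy : y ∈ K) :
    proj K y = y := by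
  have h1 := (proj_spec hne hcl y).2 hy
  simp only [Set.mem_ofPred_eq, sub_self, norm_zero] at h1
  rw [← sub_eq_zero, ← norm_eq_zero]
  exact pow_eq_zero_iff two_ne_zero |>.1 (le_antisymm (by simpa using h1) (sq_nonneg _))

theorem norm_proj_sub_le (hne : K.Nonempty) (hcl : IsClosed K) (hconv : Convex ℝ K)
    (y : Vec m) {w : Vec m} (hw : w ∈ K) : ‖proj K y - w‖ ≤ ‖y - w‖ := by
  simpa [proj_eq_self hne hcl hw] using norm_proj_sub_proj_le hne hcl hconv y w

end Projection

/-! ### Deterministic bounds along a trajectory -/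

section Trajectory

variable {n m : ℕ} {A : ℕ → Matrix (Fin n) (Fin n) ℝ} {π : ℕ → Fin n → ℝ} {C lam θ : ℝ}

theorem MixingData.phi_pos (h : MixingData A π C lam θ) (hθ : 0 < θ) (t : ℕ) (i : Fin n) :
    0 < phi A t i := (inv_pos.2 hθ).trans_le (h.phi_bounded_below t i)

theorem MixingData.inv_phi_le (h : MixingData A π C lam θ) (hθ : 0 < θ) (t : ℕ) (i : Fin n) :
    1 / phi A t i ≤ θ := by
  rw [one_div]
  exact inv_le_of_inv_le₀ hθ (h.phi_bounded_below t i)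

theorem MixingData.nonneg (h : MixingData A π C lam θ) (t : ℕ) (i : Fin n) : 0 ≤ π t i := by
  obtain ⟨β, hβ, hle⟩ := h.bounded_below
  exact hβ.le.trans (hle t i)

theorem MixingData.sum_div_phi_le (h : MixingData A π C lam θ) (hθ : 0 < θ) (t : ℕ) :
    ∑ i, π t i / phi A t i ≤ θ := by
  calc ∑ i, π t i / phi A t i ≤ ∑ i, π t i * θ := Finset.sum_le_sum fun i _ => by
        rw [div_eq_mul_one_div]
        exact mul_le_mul_of_nonneg_left (h.inv_phi_le hθ t i) (h.nonneg t i)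
    _ = θ := by rw [← Finset.sum_mul, h.sum_eq_one, one_mul]

/-- The bound for the disagreement of the decisions at round `t`, where `X` is the size of the
initial decisions and `H` bounds the oracle. -/
noncomputable def disagreement (n : ℕ) (C lam θ H X : ℝ) (α : ℕ → ℝ) (t : ℕ) : ℝ :=
  C * lam ^ t * X + n * H * θ * C * ∑ l ∈ Finset.Icc 1 t, lam ^ (t - l) * α (l - 1)

theorem disagreement_succ (n : ℕ) (C lam θ H X : ℝ) (α : ℕ → ℝ) (t : ℕ) :
    disagreement n C lam θ H X α (t + 1) =
      lam * disagreement n C lam θ H X α t + n * H * θ * C * α t := by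
  have h1 : ∑ l ∈ Finset.Icc 1 t, lam ^ (t + 1 - l) * α (l - 1) =
      lam * ∑ l ∈ Finset.Icc 1 t, lam ^ (t - l) * α (l - 1) := by
    rw [Finset.mul_sum]
    refine Finset.sum_congr rfl fun l hl => ?_
    rw [Nat.sub_add_comm (Finset.mem_Icc.1 hl).2, pow_succ]
    ring
  rw [disagreement, disagreement, Finset.sum_Icc_succ_top (by omega), h1]
  simp only [Nat.sub_self, pow_zero, Nat.add_sub_cancel]
  ring

theorem disagreement_nonneg (n : ℕ) {C lam θ H X : ℝ} {α : ℕ → ℝ} (hC : 0 ≤ C) (hlam : 0 ≤ lam)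
    (hθ : 0 ≤ θ) (hH : 0 ≤ H) (hX : 0 ≤ X) (hα : ∀ t, 0 ≤ α t) (t : ℕ) :
    0 ≤ disagreement n C lam θ H X α t := by
  have : 0 ≤ ∑ l ∈ Finset.Icc 1 t, lam ^ (t - l) * α (l - 1) :=
    Finset.sum_nonneg fun l _ => mul_nonneg (pow_nonneg hlam _) (hα _)
  unfold disagreement
  positivity

/-- The general `k` makes the induction on `t` work: going back one round lengthens the product by
one factor. Later `k = 0` is used for the decisions and `k = 1` for their averages. -/
theorem norm_sum_transition_sub_le (h : MixingData A π C lam θ)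
    (hC : 0 ≤ C) (hlam : 0 ≤ lam) {α : ℕ → ℝ} {H : ℝ}
    {x e : ℕ → Fin n → Vec m} (hx : ∀ t i, x (t + 1) i = ∑ j, mixing A t i j • x t j + e t i)
    (he : ∀ t i, ‖e t i‖ ≤ θ * α t * H) (t k : ℕ) (i : Fin n) :
    ‖∑ j, (transition A t k i j - π t j) • x t j‖ ≤
      lam ^ k * disagreement n C lam θ H (∑ j, ‖x 0 j‖) α t := by
  have hbound : ∀ (t k : ℕ) (v : Fin n → Vec m),
      ‖∑ j, (transition A t k i j - π t j) • v j‖ ≤ C * lam ^ k * ∑ j, ‖v j‖ := by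
    intro t k v
    rw [Finset.mul_sum]
    refine norm_sum_le_of_le _ fun j _ => ?_
    rw [norm_smul]
    exact mul_le_mul_of_nonneg_right (h.geometric t k i j) (norm_nonneg _)
  induction t generalizing k with
  | zero =>
    refine (hbound 0 k (x 0)).trans (le_of_eq ?_)
    simp [disagreement]
    ring
  | succ t ih =>
    have e1 : ∑ j, (transition A (t + 1) k i j - π (t + 1) j) • x (t + 1) j =
        ∑ j, (transition A t (k + 1) i j - π t j) • x t j +
          ∑ j, (transition A (t + 1) k i j - π (t + 1) j) • e t j := by
      simp only [hx, smul_add, Finset.sum_add_distrib]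
      congr 1
      -- By left invariance, the deviation from `π` at `t + 1` times `ℬ_t` is the deviation at `t`.
      have e2 : ∀ j, transition A t (k + 1) i j - π t j =
          ∑ l, (transition A (t + 1) k i l - π (t + 1) l) * mixing A t l j := by
        intro j
        have h1 : π t j = ∑ l, π (t + 1) l * mixing A t l j := by
          conv_lhs => rw [h.left_invariant t]
          rfl
        rw [transition_succ', Matrix.mul_apply, h1]
        simp only [sub_mul, Finset.sum_sub_distrib]
      simp only [e2, Finset.sum_smul, Finset.smul_sum, smul_smul]
      exact Finset.sum_comm
    rw [e1, disagreement_succ]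
    have h1 := hbound (t + 1) k (e t)
    have h2 : ∑ j, ‖e t j‖ ≤ n * (θ * α t * H) := by
      refine (Finset.sum_le_sum fun j _ => he t j).trans (le_of_eq ?_)
      simp
    calc _ ≤ lam ^ (k + 1) * disagreement n C lam θ H (∑ j, ‖x 0 j‖) α t +
          C * lam ^ k * (n * (θ * α t * H)) :=
          (norm_add_le _ _).trans (add_le_add (ih (k + 1)) (h1.trans
            (mul_le_mul_of_nonneg_left h2 (mul_nonneg hC (pow_nonneg hlam k)))))
      _ = _ := by ring

theorem norm_sub_weightedMean_le (h : MixingData A π C lam θ)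
    (hC : 0 ≤ C) (hlam : 0 ≤ lam) {α : ℕ → ℝ} {H : ℝ}
    {x e : ℕ → Fin n → Vec m} (hx : ∀ t i, x (t + 1) i = ∑ j, mixing A t i j • x t j + e t i)
    (he : ∀ t i, ‖e t i‖ ≤ θ * α t * H) (t : ℕ) (i : Fin n) :
    ‖x t i - weightedMean π x t‖ ≤ disagreement n C lam θ H (∑ j, ‖x 0 j‖) α t := by
  have := norm_sum_transition_sub_le h hC hlam hx he t 0 i
  simp only [transition, sub_smul, Finset.sum_sub_distrib, pow_zero, one_mul] at this
  simpa [Matrix.one_apply, weightedMean] using this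

theorem norm_mixing_sub_weightedMean_le (h : MixingData A π C lam θ)
    (hC : 0 ≤ C) (hlam : 0 ≤ lam) {α : ℕ → ℝ} {H : ℝ}
    {x e : ℕ → Fin n → Vec m} (hx : ∀ t i, x (t + 1) i = ∑ j, mixing A t i j • x t j + e t i)
    (he : ∀ t i, ‖e t i‖ ≤ θ * α t * H) (t : ℕ) (i : Fin n) :
    ‖∑ j, mixing A t i j • x t j - weightedMean π x t‖ ≤
      lam * disagreement n C lam θ H (∑ j, ‖x 0 j‖) α t := by
  have := norm_sum_transition_sub_le h hC hlam hx he t 1 i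
  simpa [transition, sub_smul, Finset.sum_sub_distrib, weightedMean] using this

/-! ### Weighted square distances and the projected step -/

/-- The weighted mean square distance of the decisions of round `t` to a point. -/
noncomputable def spread (π : ℕ → Fin n → ℝ) (x : ℕ → Fin n → Vec m) (t : ℕ) (y : Vec m) : ℝ :=
  ∑ i, π t i * ‖x t i - y‖ ^ 2

/-- Jensen's inequality in each row, after which left invariance turns the weights `π (t + 1)` into
`π t`. -/
theorem sum_norm_mixing_sub_sq_le (h : MixingData A π C lam θ) (hA : ∀ t i j, 0 ≤ A t i j)
    (hφ : ∀ t i, 0 < phi A t i) (x : ℕ → Fin n → Vec m) (t : ℕ) (y : Vec m) :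
    ∑ i, π (t + 1) i * ‖∑ j, mixing A t i j • x t j - y‖ ^ 2 ≤ spread π x t y := by
  have hconv : ConvexOn ℝ Set.univ fun v : Vec m => ‖v‖ ^ 2 :=
    (convexOn_norm convex_univ).pow (fun _ _ => norm_nonneg _) 2
  have h1 : ∀ i, ‖∑ j, mixing A t i j • x t j - y‖ ^ 2 ≤
      ∑ j, mixing A t i j * ‖x t j - y‖ ^ 2 := by
    intro i
    have e1 : ∑ j, mixing A t i j • x t j - y = ∑ j, mixing A t i j • (x t j - y) := by
      simp only [smul_sub, Finset.sum_sub_distrib, ← Finset.sum_smul, sum_mixing hφ, one_smul]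
    rw [e1]
    exact hconv.map_sum_le (fun j _ => mixing_nonneg hA hφ t i j) (sum_mixing hφ t i)
      fun _ _ => Set.mem_univ _
  calc _ ≤ ∑ i, π (t + 1) i * ∑ j, mixing A t i j * ‖x t j - y‖ ^ 2 :=
        Finset.sum_le_sum fun i _ => mul_le_mul_of_nonneg_left (h1 i) (h.nonneg _ _)
    _ = spread π x t y := by
        unfold spread
        simp only [Finset.mul_sum]
        rw [Finset.sum_comm]
        refine Finset.sum_congr rfl fun j _ => ?_
        conv_rhs => rw [h.left_invariant t]
        simp only [Matrix.vecMul, dotProduct, Finset.sum_mul, mul_assoc]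

theorem spread_nonneg (h : MixingData A π C lam θ) (x : ℕ → Fin n → Vec m) (t : ℕ) (y : Vec m) :
    0 ≤ spread π x t y :=
  Finset.sum_nonneg fun i _ => mul_nonneg (h.nonneg t i) (sq_nonneg _)

theorem spread_le (h : MixingData A π C lam θ) {x : ℕ → Fin n → Vec m} {t : ℕ} {y : Vec m}
    {R : ℝ} (hx : ∀ i, ‖x t i‖ ≤ R) (hy : ‖y‖ ≤ R) : spread π x t y ≤ 4 * R ^ 2 := by
  calc spread π x t y ≤ ∑ i, π t i * (4 * R ^ 2) := Finset.sum_le_sum fun i _ => by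
        refine mul_le_mul_of_nonneg_left ?_ (h.nonneg t i)
        have h1 : ‖x t i - y‖ ≤ 2 * R := (norm_sub_le _ _).trans (by linarith [hx i])
        nlinarith [norm_nonneg (x t i - y)]
    _ = 4 * R ^ 2 := by rw [← Finset.sum_mul, h.sum_eq_one, one_mul]

theorem spread_sub_spread_le (h : MixingData A π C lam θ) {x : ℕ → Fin n → Vec m} {t : ℕ}
    {y z : Vec m} {R : ℝ} (hx : ∀ i, ‖x t i‖ ≤ R) (hy : ‖y‖ ≤ R) (hz : ‖z‖ ≤ R) :
    spread π x t y - spread π x t z ≤ 4 * R * ‖y - z‖ := by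
  unfold spread
  rw [← Finset.sum_sub_distrib]
  calc _ ≤ ∑ i, π t i * (4 * R * ‖y - z‖) := Finset.sum_le_sum fun i _ => by
        rw [← mul_sub]
        refine mul_le_mul_of_nonneg_left ?_ (h.nonneg t i)
        have h1 : ‖x t i - y‖ ≤ 2 * R := (norm_sub_le _ _).trans (by linarith [hx i])
        have h2 : ‖x t i - z‖ ≤ 2 * R := (norm_sub_le _ _).trans (by linarith [hx i])
        have h3 : ‖x t i - y‖ - ‖x t i - z‖ ≤ ‖y - z‖ := by
          refine (norm_sub_norm_le _ _).trans (le_of_eq ?_)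
          rw [sub_sub_sub_cancel_left, norm_sub_rev]
        nlinarith [norm_nonneg (x t i - y), norm_nonneg (x t i - z), norm_nonneg (y - z)]
    _ = _ := by rw [← Finset.sum_mul, h.sum_eq_one, one_mul]

theorem sum_mul_sub_succ_le {a V : ℕ → ℝ} {M : ℝ} (ha : Monotone a) (ha0 : ∀ t, 0 ≤ a t)
    (hV0 : ∀ t, 0 ≤ V t) (hV : ∀ t, V t ≤ M) (T : ℕ) :
    ∑ t ∈ Finset.range (T + 1), a t * (V t - V (t + 1)) ≤ a T * M := by
  -- Summation by parts; the boundary term is kept so that the induction closes.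
  have key : ∑ t ∈ Finset.range (T + 1), a t * (V t - V (t + 1)) + a T * V (T + 1) ≤ a T * M := by
    induction T with
    | zero =>
      simp only [zero_add, Finset.sum_range_one]
      linarith [mul_le_mul_of_nonneg_left (hV 0) (ha0 0)]
    | succ T ih =>
      rw [Finset.sum_range_succ]
      have := mul_le_mul_of_nonneg_left (hV (T + 1)) (sub_nonneg.2 (ha (Nat.le_succ T)))
      linarith
  linarith [mul_nonneg (ha0 T) (hV0 (T + 1))]

/-- The step of node `i` carries the factor `1 / φ_{i,t+1}`, so weighting the usual one-step
inequalities by `π_{i,t+1}` yields exactly the weights of the regret. -/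
theorem sum_inner_le_of_projected_step (h : MixingData A π C lam θ) (hA : ∀ t i j, 0 ≤ A t i j)
    (hC : 0 ≤ C) (hlam : 0 ≤ lam) (hθ : 0 < θ) {K : Set (Vec m)} (hne : K.Nonempty)
    (hcl : IsClosed K) (hconv : Convex ℝ K) {α : ℕ → ℝ} (hα : ∀ t, 0 < α t) {H : ℝ} (hH : 0 ≤ H)
    {x g : ℕ → Fin n → Vec m} (hx0 : ∀ i, x 0 i ∈ K)
    (hx : ∀ t i, x (t + 1) i = proj K (∑ j, mixing A t i j • x t j -
      (1 / phi A (t + 1) i * α t) • g t i)) (hg : ∀ t i, ‖g t i‖ ≤ H) (t : ℕ) {y : Vec m}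
    (hy : y ∈ K) :
    (∀ i, ‖x t i - weightedMean π x t‖ ≤ disagreement n C lam θ H (∑ j, ‖x 0 j‖) α t) ∧
    ∑ i, π (t + 1) i / phi A (t + 1) i * inner ℝ (g t i) (x t i - y) ≤
      θ * H * ((1 + lam) * disagreement n C lam θ H (∑ j, ‖x 0 j‖) α t) +
        θ ^ 2 * H ^ 2 / 2 * α t +
        1 / (2 * α t) * (spread π x t y - spread π x (t + 1) y) := by
  have hφ := h.phi_pos hθ
  have hxK : ∀ t i, x t i ∈ K := by
    intro t i
    cases t with
    | zero => exact hx0 i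
    | succ t => rw [hx]; exact proj_mem hne hcl _
  set v : ℕ → Fin n → Vec m := fun t i => ∑ j, mixing A t i j • x t j with hv
  have hvK : ∀ t i, v t i ∈ K := fun t i =>
    hconv.sum_mem (fun j _ => mixing_nonneg hA hφ t i j) (sum_mixing hφ t i) fun j _ => hxK t j
  set e : ℕ → Fin n → Vec m := fun t i => x (t + 1) i - v t i with he
  have hxe : ∀ t i, x (t + 1) i = ∑ j, mixing A t i j • x t j + e t i := fun t i => by
    simp only [he, hv]
    abel
  have hcoef : ∀ t i, 0 ≤ 1 / phi A (t + 1) i * α t := fun t i =>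
    mul_nonneg (one_div_pos.2 (hφ _ _)).le (hα t).le
  -- The average `v t i` already lies in `K`, so the projected point is no farther from it than the
  -- unprojected one.
  have heb : ∀ t i, ‖e t i‖ ≤ θ * α t * H := fun t i => by
    calc ‖e t i‖ ≤ ‖(1 / phi A (t + 1) i * α t) • g t i‖ := by
          have := norm_proj_sub_le hne hcl hconv
            (v t i - (1 / phi A (t + 1) i * α t) • g t i) (hvK t i)
          rw [← hx] at this
          refine this.trans (le_of_eq ?_)
          rw [sub_sub_cancel_left, norm_neg]
      _ ≤ θ * α t * H := by
          rw [norm_smul, Real.norm_of_nonneg (hcoef t i)]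
          exact mul_le_mul (mul_le_mul_of_nonneg_right (h.inv_phi_le hθ _ _) (hα t).le) (hg t i)
            (norm_nonneg _) (mul_nonneg hθ.le (hα t).le)
  have hcons := norm_sub_weightedMean_le h hC hlam hxe heb
  have hcons' := norm_mixing_sub_weightedMean_le h hC hlam hxe heb
  set D := disagreement n C lam θ H (∑ j, ‖x 0 j‖) α
  refine ⟨hcons t, ?_⟩
  have hstep : ∀ i, π (t + 1) i / phi A (t + 1) i * inner ℝ (g t i) (x t i - y) ≤
      π (t + 1) i / phi A (t + 1) i * (H * ((1 + lam) * D t)) +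
      π (t + 1) i * (θ ^ 2 * H ^ 2 / 2 * α t) +
      1 / (2 * α t) * (π (t + 1) i * ‖v t i - y‖ ^ 2 - π (t + 1) i * ‖x (t + 1) i - y‖ ^ 2) := by
    intro i
    set b := 1 / phi A (t + 1) i with hb
    have hb0 : 0 ≤ b := (one_div_pos.2 (hφ _ _)).le
    have hbθ : b ≤ θ := h.inv_phi_le hθ _ _
    -- The oracle is queried at `x t i` but the step starts from `v t i`; their distances to the
    -- weighted mean are at most `D t` and `lam * D t`.
    have h1 : inner ℝ (g t i) (x t i - v t i) ≤ H * ((1 + lam) * D t) := by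
      refine (real_inner_le_norm _ _).trans
        (mul_le_mul (hg t i) ?_ (norm_nonneg _) hH)
      have h2 : ‖x t i - v t i‖ ≤ ‖x t i - weightedMean π x t‖ + ‖v t i - weightedMean π x t‖ := by
        rw [← sub_sub_sub_cancel_right (x t i) (v t i) (weightedMean π x t)]
        exact norm_sub_le _ _
      linarith [hcons t i, hcons' t i]
    have h2 : ‖x (t + 1) i - y‖ ^ 2 ≤
        ‖v t i - y‖ ^ 2 - 2 * (b * α t * inner ℝ (g t i) (v t i - y)) + (b * α t) ^ 2 * H ^ 2 := by
      have h3 := norm_proj_sub_le hne hcl hconv (v t i - (b * α t) • g t i) hy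
      rw [← hx, sub_right_comm] at h3
      have h4 := pow_le_pow_left₀ (norm_nonneg _) h3 2
      rw [norm_sub_sq_real (v t i - y), real_inner_smul_right, norm_smul, mul_pow,
        Real.norm_eq_abs, sq_abs, real_inner_comm (g t i)] at h4
      have h5 : ‖g t i‖ ^ 2 ≤ H ^ 2 := pow_le_pow_left₀ (norm_nonneg _) (hg t i) 2
      have h6 := mul_le_mul_of_nonneg_left h5 (sq_nonneg (b * α t))
      linarith
    have h3 : b * inner ℝ (g t i) (v t i - y) ≤ θ ^ 2 * H ^ 2 / 2 * α t +
        1 / (2 * α t) * (‖v t i - y‖ ^ 2 - ‖x (t + 1) i - y‖ ^ 2) := by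
      have hαt := hα t
      have h4 : b ^ 2 ≤ θ ^ 2 := pow_le_pow_left₀ hb0 hbθ 2
      have h5 : (b * α t) ^ 2 * H ^ 2 ≤ θ ^ 2 * H ^ 2 * α t ^ 2 := by
        have := mul_le_mul_of_nonneg_right h4 (mul_nonneg (sq_nonneg (α t)) (sq_nonneg H))
        linarith
      have h6 : 2 * α t * (b * inner ℝ (g t i) (v t i - y)) ≤ 2 * α t *
          (θ ^ 2 * H ^ 2 / 2 * α t +
            1 / (2 * α t) * (‖v t i - y‖ ^ 2 - ‖x (t + 1) i - y‖ ^ 2)) := by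
        rw [mul_add, ← mul_assoc (2 * α t) (1 / (2 * α t)), mul_one_div_cancel (by positivity)]
        linarith
      exact le_of_mul_le_mul_left h6 (by positivity)
    have hsplit : inner ℝ (g t i) (x t i - y) =
        inner ℝ (g t i) (x t i - v t i) + inner ℝ (g t i) (v t i - y) := by
      rw [← inner_add_right, sub_add_sub_cancel]
    have hπ := h.nonneg (t + 1) i
    have h4 := mul_le_mul_of_nonneg_left h1 (mul_nonneg hπ hb0)
    have h5 := mul_le_mul_of_nonneg_left h3 hπ
    rw [div_eq_mul_one_div, ← hb, hsplit]
    linarith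
  refine (Finset.sum_le_sum fun i _ => hstep i).trans ?_
  rw [Finset.sum_add_distrib, Finset.sum_add_distrib, ← Finset.sum_mul, ← Finset.sum_mul,
    ← Finset.mul_sum, Finset.sum_sub_distrib, h.sum_eq_one, one_mul]
  have h1 := sum_norm_mixing_sub_sq_le h hA hφ x t y
  have hD : 0 ≤ D t := disagreement_nonneg n hC hlam hθ.le hH
    (Finset.sum_nonneg fun _ _ => norm_nonneg _) (fun t => (hα t).le) t
  have h2 := mul_le_mul_of_nonneg_right (h.sum_div_phi_le hθ (t + 1))
    (mul_nonneg hH (mul_nonneg (by linarith : 0 ≤ 1 + lam) hD))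
  have h3 : 1 / (2 * α t) * (∑ i, π (t + 1) i * ‖v t i - y‖ ^ 2 -
      ∑ i, π (t + 1) i * ‖x (t + 1) i - y‖ ^ 2) ≤
      1 / (2 * α t) * (spread π x t y - spread π x (t + 1) y) := by
    refine mul_le_mul_of_nonneg_left ?_ (one_div_pos.2 (mul_pos two_pos (hα t))).le
    simp only [spread, hv] at h1 ⊢
    linarith
  linarith

/-- Exchanging `y t` for `y (t + 1)` restores the telescoping sum; on the ball of radius `R` each
exchange costs at most `4 * R * ‖y (t + 1) - y t‖`. -/
theorem sum_weighted_spread_le (h : MixingData A π C lam θ) {α : ℕ → ℝ} (hα : ∀ t, 0 < α t)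
    (hanti : Antitone α) {x : ℕ → Fin n → Vec m} {y : ℕ → Vec m} {R : ℝ}
    (hx : ∀ t i, ‖x t i‖ ≤ R) (hy : ∀ t, ‖y t‖ ≤ R) (T : ℕ) :
    ∑ t ∈ Finset.range (T + 1),
      1 / (2 * α t) * (spread π x t (y t) - spread π x (t + 1) (y t)) ≤
      2 * R ^ 2 / α T + 2 * R / α T * ∑ t ∈ Finset.range (T + 1), ‖y (t + 1) - y t‖ := by
  have hR : 0 ≤ R := (norm_nonneg _).trans (hy 0)
  have hmono : Monotone fun t => 1 / (2 * α t) := fun s t hst =>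
    one_div_le_one_div_of_le (mul_pos two_pos (hα t))
      (mul_le_mul_of_nonneg_left (hanti hst) two_pos.le)
  have hpos : ∀ t, 0 ≤ 1 / (2 * α t) := fun t => (one_div_pos.2 (mul_pos two_pos (hα t))).le
  have h1 := sum_mul_sub_succ_le hmono hpos (V := fun t => spread π x t (y t)) (M := 4 * R ^ 2)
    (fun t => spread_nonneg h x t _) (fun t => spread_le h (hx t) (hy t)) T
  have h2 : ∑ t ∈ Finset.range (T + 1),
      1 / (2 * α t) * (spread π x (t + 1) (y (t + 1)) - spread π x (t + 1) (y t)) ≤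
      ∑ t ∈ Finset.range (T + 1), 1 / (2 * α T) * (4 * R * ‖y (t + 1) - y t‖) := by
    refine Finset.sum_le_sum fun t ht => ?_
    have h3 := spread_sub_spread_le h (hx (t + 1)) (hy (t + 1)) (hy t)
    calc _ ≤ 1 / (2 * α t) * (4 * R * ‖y (t + 1) - y t‖) :=
          mul_le_mul_of_nonneg_left h3 (hpos t)
      _ ≤ _ := mul_le_mul_of_nonneg_right
          (hmono (Nat.lt_succ_iff.1 (Finset.mem_range.1 ht))) (by positivity)
  have hT := (hα T).ne'
  calc _ = ∑ t ∈ Finset.range (T + 1),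
        1 / (2 * α t) * (spread π x t (y t) - spread π x (t + 1) (y (t + 1))) +
      ∑ t ∈ Finset.range (T + 1),
        1 / (2 * α t) * (spread π x (t + 1) (y (t + 1)) - spread π x (t + 1) (y t)) := by
        rw [← Finset.sum_add_distrib]
        exact Finset.sum_congr rfl fun t _ => by ring
    _ ≤ 1 / (2 * α T) * (4 * R ^ 2) +
        ∑ t ∈ Finset.range (T + 1), 1 / (2 * α T) * (4 * R * ‖y (t + 1) - y t‖) := add_le_add h1 h2
    _ = _ := by
        rw [← Finset.mul_sum, ← Finset.mul_sum]
        field_simp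
        ring

end Trajectory

/-! ### The decisions of the algorithm -/

section Decisions

variable {n m : ℕ} {A : ℕ → Matrix (Fin n) (Fin n) ℝ} {K : Set (Vec m)} {r R G ξ μ : ℝ}
  {α : ℕ → ℝ} {f : Fin n → ℕ → Vec m → ℝ} {x₀ : Fin n → Vec m}

theorem CostAssumption.lipschitzOnWith (h : CostAssumption K r R G f) (i : Fin n) (t : ℕ) :
    LipschitzOnWith G.toNNReal (f i t) K := by
  have key : ∀ x ∈ K, ∀ y ∈ K, f i t x - f i t y ≤ G * ‖x - y‖ := by
    intro x hx y hy
    obtain ⟨g, hg, hgG⟩ := h.bounded_subgradient i t x hx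
    have h1 := hg y hy
    have h2 := abs_real_inner_le_norm g (y - x)
    have h3 := neg_abs_le (inner ℝ g (y - x))
    have h4 := mul_le_mul_of_nonneg_right hgG (norm_nonneg (y - x))
    rw [norm_sub_rev]
    linarith
  refine LipschitzOnWith.of_dist_le_mul fun x hx y hy => ?_
  rw [Real.coe_toNNReal _ h.G_pos.le, Real.dist_eq, dist_eq_norm, abs_le]
  have h1 := key x hx y hy
  have h2 := key y hy x hx
  rw [norm_sub_rev] at h2
  constructor <;> linarith

theorem CostAssumption.zero_mem (h : CostAssumption K r R G f) : (0 : Vec m) ∈ K :=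
  h.ball_subset (by simpa using h.r_pos.le)

theorem CostAssumption.norm_le (h : CostAssumption K r R G f) {x : Vec m} (hx : x ∈ K) :
    ‖x‖ ≤ R := by
  simpa using h.subset_ball hx

theorem CostAssumption.le_radius (h : CostAssumption K r R G f) (hm : 0 < m) : r ≤ R := by
  have h1 : ‖(EuclideanSpace.single ⟨0, hm⟩ r : Vec m)‖ = r := by
    simp [abs_of_pos h.r_pos]
  rw [← h1]
  exact h.norm_le (h.ball_subset (by simp [abs_of_pos h.r_pos]))

theorem CostAssumption.congr {f' : Fin n → ℕ → Vec m → ℝ} (h : CostAssumption K r R G f)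
    (hf : ∀ i t, Set.EqOn (f i t) (f' i t) K) : CostAssumption K r R G f' where
  convex_set := h.convex_set
  closed_set := h.closed_set
  r_pos := h.r_pos
  R_pos := h.R_pos
  ball_subset := h.ball_subset
  subset_ball := h.subset_ball
  convex_cost i t := (h.convex_cost i t).congr (hf i t)
  G_pos := h.G_pos
  bounded_subgradient i t x hx := by
    obtain ⟨g, hg, hgG⟩ := h.bounded_subgradient i t x hx
    refine ⟨g, fun y hy => ?_, hgG⟩
    rw [← hf i t hx, ← hf i t hy]
    exact hg y hy

/-- By convexity `(1 - ξ) k + ξ b` lies in `K` for `k ∈ K` and `‖b‖ ≤ r`: this is the room for the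
query points `x + μ ζ`. -/
theorem CostAssumption.closedBall_subset (h : CostAssumption K r R G f)
    (hξ : ξ ∈ Set.Ioo (0 : ℝ) 1) (hμ : μ ≤ r * ξ) {x : Vec m} (hx : x ∈ (1 - ξ) • K) :
    Metric.closedBall x μ ⊆ K := by
  obtain ⟨k, hk, rfl⟩ := hx
  intro z hz
  simp only [Metric.mem_closedBall, dist_eq_norm] at hz
  have h1 : ξ⁻¹ • (z - (1 - ξ) • k) ∈ K := by
    refine h.ball_subset ?_
    rw [mem_closedBall_zero_iff, norm_smul, norm_inv, Real.norm_of_nonneg hξ.1.le,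
      inv_mul_le_iff₀ hξ.1]
    linarith
  have h2 := h.convex_set hk h1 (by linarith [hξ.2] : 0 ≤ 1 - ξ) hξ.1.le (by ring)
  rw [smul_inv_smul₀ hξ.1.ne'] at h2
  simpa using h2

theorem CostAssumption.isClosed_smul (h : CostAssumption K r R G f) (hξ : ξ ∈ Set.Ioo (0 : ℝ) 1) :
    IsClosed ((1 - ξ) • K) :=
  h.closed_set.smul_of_ne_zero (by linarith [hξ.2])

theorem CostAssumption.nonempty_smul (h : CostAssumption K r R G f) :
    ((1 - ξ) • K).Nonempty := ⟨_, Set.smul_mem_smul_set h.zero_mem⟩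

theorem decision_mem (h : CostAssumption K r R G f) (hξ : ξ ∈ Set.Ioo (0 : ℝ) 1)
    (hx₀ : ∀ i, x₀ i ∈ (1 - ξ) • K) (z : Fin n → ℕ → UnitSphere m) (t : ℕ) (i : Fin n) :
    decision A K ξ μ α f x₀ z t i ∈ (1 - ξ) • K := by
  cases t with
  | zero => exact hx₀ i
  | succ t => exact proj_mem h.nonempty_smul (h.isClosed_smul hξ) _

/-- All queries lie in `K`. Hence the costs may be replaced by Lipschitz extensions to the whole
space. -/
theorem decision_congr (h : CostAssumption K r R G f) (hξ : ξ ∈ Set.Ioo (0 : ℝ) 1)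
    (hμ : μ ∈ Set.Ioc 0 (r * ξ)) (hx₀ : ∀ i, x₀ i ∈ (1 - ξ) • K) {f' : Fin n → ℕ → Vec m → ℝ}
    (hf : ∀ i t, Set.EqOn (f i t) (f' i t) K) (z : Fin n → ℕ → UnitSphere m) (t : ℕ) :
    decision A K ξ μ α f x₀ z t = decision A K ξ μ α f' x₀ z t := by
  induction t with
  | zero => rfl
  | succ t ih =>
    funext i
    have hball := h.closedBall_subset hξ hμ.2
      (decision_mem (A := A) (μ := μ) (α := α) h hξ hx₀ z t i)
    have h1 : oracle (f i t) μ (z i t) (decision A K ξ μ α f x₀ z t i) =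
        oracle (f' i t) μ (z i t) (decision A K ξ μ α f x₀ z t i) := by
      rw [oracle, oracle, hf i t (hball (by simp [norm_smul, abs_of_pos hμ.1])),
        hf i t (hball (by simpa using hμ.1.le))]
    simp only [decision]
    rw [h1, ih]

theorem norm_oracle_le {g : Vec m → ℝ} {G : NNReal} (hg : LipschitzWith G g) (hμ : 0 < μ)
    (ζ : UnitSphere m) (x : Vec m) : ‖oracle g μ ζ x‖ ≤ m * G := by
  have hζ : ‖(ζ : Vec m)‖ = 1 := by simp
  have h1 := hg.dist_le_mul (x + μ • (ζ : Vec m)) x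
  rw [Real.dist_eq, dist_eq_norm, add_sub_cancel_left, norm_smul, hζ, mul_one,
    Real.norm_of_nonneg hμ.le] at h1
  rw [oracle, norm_smul, hζ, mul_one, norm_mul, Real.norm_eq_abs (g _ - g _),
    Real.norm_of_nonneg (by positivity)]
  calc (m : ℝ) / μ * |g (x + μ • (ζ : Vec m)) - g x| ≤ m / μ * (G * μ) :=
        mul_le_mul_of_nonneg_left h1 (by positivity)
    _ = m * G := by field_simp

theorem continuous_oracle {g : Vec m → ℝ} (hg : Continuous g) :
    Continuous fun p : UnitSphere m × Vec m => oracle g μ p.1 p.2 := by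
  unfold oracle
  fun_prop

/-- Only directions of rounds before `t` are assumed measurable, so the σ-algebra on `S` can be the
one they generate. This is how independence of `ζ i t` from the decision is obtained. -/
theorem measurable_decision {S : Type*} [MeasurableSpace S] (h : CostAssumption K r R G f)
    (hξ : ξ ∈ Set.Ioo (0 : ℝ) 1) (hf : ∀ i t, Continuous (f i t))
    {ζ : Fin n → ℕ → S → UnitSphere m} (t : ℕ) (hζ : ∀ j, ∀ s < t, Measurable (ζ j s)) (i : Fin n) :
    Measurable fun ω => decision A K ξ μ α f x₀ (fun i s => ζ i s ω) t i := by
  induction t generalizing i with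
  | zero => exact measurable_const
  | succ t ih =>
    have ih' := ih fun j s hs => hζ j s (hs.trans (Nat.lt_succ_self t))
    have hproj : Measurable (proj ((1 - ξ) • K)) :=
      (continuous_proj h.nonempty_smul (h.isClosed_smul hξ) (h.convex_set.smul _)).measurable
    obtain ⟨d, hd⟩ : ∃ d : S → Fin n → Vec m,
        ∀ ω, decision A K ξ μ α f x₀ (fun i s => ζ i s ω) t = d ω := ⟨_, fun _ => rfl⟩
    simp only [hd] at ih'
    simp only [decision, hd]
    have hor : Measurable fun ω => oracle (f i t) μ (ζ i t ω) (d ω i) := by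
      have := (continuous_oracle (μ := μ) (hf i t)).measurable.comp
        ((hζ i t (Nat.lt_succ_self t)).prodMk (ih' i))
      exact this
    refine hproj.comp (Measurable.sub ?_ (hor.fun_const_smul _))
    exact Finset.measurable_fun_sum _ fun j _ => (ih' j).fun_const_smul _

end Decisions

/-! ### Expectations -/

section Expectation

variable {n m : ℕ} {S : Type*} [MeasurableSpace S] {P : Measure S}

theorem RandomDirections.indepFun_decision {A : ℕ → Matrix (Fin n) (Fin n) ℝ} {K : Set (Vec m)}
    {r R G ξ μ : ℝ} {α : ℕ → ℝ} {f : Fin n → ℕ → Vec m → ℝ} {x₀ : Fin n → Vec m}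
    {ζ : Fin n → ℕ → S → UnitSphere m} (hζ : RandomDirections P ζ) (h : CostAssumption K r R G f)
    (hξ : ξ ∈ Set.Ioo (0 : ℝ) 1) (hf : ∀ i t, Continuous (f i t)) (t : ℕ) (i : Fin n) :
    IndepFun (ζ i t) (fun ω => decision A K ξ μ α f x₀ (fun i s => ζ i s ω) t i) P := by
  rw [IndepFun_iff_Indep]
  refine indep_of_indep_of_le_right (hζ.indep_past i t) ?_
  refine Measurable.comap_le ?_
  refine @measurable_decision n m A K r R G ξ μ α f x₀ S
    (⨆ s, ⨆ (_ : s < t), ⨆ j, MeasurableSpace.comap (ζ j s) inferInstance) h hξ hf ζ t ?_ i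
  intro j s hs
  refine Measurable.mono (comap_measurable (ζ j s)) ?_ le_rfl
  exact le_iSup_of_le s (le_iSup_of_le hs (le_iSup_of_le j le_rfl))

theorem integrable_of_abs_le [IsFiniteMeasure P] {F : S → ℝ} (hF : Measurable F) {c : ℝ}
    (hc : ∀ ω, |F ω| ≤ c) : Integrable F P :=
  Integrable.of_bound hF.aestronglyMeasurable c (.of_forall hc)

/-- By independence the joint law of `Z` and `X` is a product; Fubini reduces the claim to the
oracle inequality at each fixed value of `X`. -/
theorem integral_sub_le_integral_inner_oracle [IsProbabilityMeasure P] (hm : 0 < m)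
    {X : S → Vec m} {Z : S → UnitSphere m} (hX : Measurable X) (hZ : Measurable Z)
    (hunif : P.map Z = uniformSphere m) (hind : IndepFun Z X P) {K : Set (Vec m)}
    {f : Vec m → ℝ} {G : NNReal} (hf : LipschitzWith G f) (hconv : ConvexOn ℝ K f) {μ : ℝ}
    (hμ : 0 < μ) (hXK : ∀ ω, Metric.closedBall (X ω) μ ⊆ K) {y : Vec m}
    (hy : Metric.closedBall y μ ⊆ K) {R : ℝ} (hR : ∀ ω, ‖X ω - y‖ ≤ R) :
    Integrable (fun ω => f (X ω) - f y) P ∧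
    Integrable (fun ω => inner ℝ (oracle f μ (Z ω) (X ω)) (X ω - y)) P ∧
    ∫ ω, (f (X ω) - f y) ∂P - μ * G ≤
      ∫ ω, inner ℝ (oracle f μ (Z ω) (X ω)) (X ω - y) ∂P := by
  have hfm : Measurable f := hf.continuous.measurable
  set F : UnitSphere m × Vec m → ℝ := fun p => inner ℝ (oracle f μ p.1 p.2) (p.2 - y) with hFdef
  have hF : Continuous F := (continuous_oracle hf.continuous).inner (by fun_prop)
  have hmap : P.map (fun ω => (Z ω, X ω)) = (uniformSphere m).prod (P.map X) := by
    rw [← hunif]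
    exact (indepFun_iff_map_prod_eq_prod_map_map hZ.aemeasurable hX.aemeasurable).1 hind
  have hZX : Measurable fun ω => (Z ω, X ω) := hZ.prodMk hX
  have i1 : Integrable (fun ω => f (X ω) - f y) P := by
    refine integrable_of_abs_le (c := G * R) ((hfm.comp hX).sub_const _) fun ω => ?_
    have := hf.dist_le_mul (X ω) y
    rw [Real.dist_eq, dist_eq_norm] at this
    exact this.trans (mul_le_mul_of_nonneg_left (hR ω) G.2)
  have i2 : Integrable (fun ω => F (Z ω, X ω)) P := by
    refine integrable_of_abs_le (c := m * G * R) (hF.measurable.comp hZX) fun ω => ?_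
    exact (abs_real_inner_le_norm _ _).trans
      (mul_le_mul (norm_oracle_le hf hμ _ _) (hR ω) (norm_nonneg _) (by positivity))
  refine ⟨i1, i2, ?_⟩
  have := isProbabilityMeasure_uniformSphere hm
  have := Measure.isProbabilityMeasure_map (μ := P) hX.aemeasurable
  have i3 : Integrable F ((uniformSphere m).prod (P.map X)) := by
    rw [← hmap]
    exact (integrable_map_measure hF.measurable.aestronglyMeasurable hZX.aemeasurable).2 i2
  have i4 : Integrable (fun x => ∫ z, F (z, x) ∂uniformSphere m) (P.map X) := i3.integral_prod_right
  have i5 : Integrable (fun ω => ∫ z, F (z, X ω) ∂uniformSphere m) P :=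
    (integrable_map_measure i4.aestronglyMeasurable hX.aemeasurable).1 i4
  calc ∫ ω, (f (X ω) - f y) ∂P - μ * G = ∫ ω, (f (X ω) - f y - μ * G) ∂P := by
        rw [integral_sub i1 (integrable_const _)]
        simp
    _ ≤ ∫ ω, ∫ z, F (z, X ω) ∂uniformSphere m ∂P :=
        integral_mono (i1.sub (integrable_const _)) i5 fun ω =>
          sub_le_integral_inner_oracle hm hf hconv hμ (hXK ω) hy
    _ = ∫ x, ∫ z, F (z, x) ∂uniformSphere m ∂P.map X :=
        (integral_map hX.aemeasurable i4.aestronglyMeasurable).symm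
    _ = ∫ p, F p ∂(uniformSphere m).prod (P.map X) := (integral_prod_symm F i3).symm
    _ = ∫ ω, F (Z ω, X ω) ∂P := by
        rw [← hmap, integral_map hZX.aemeasurable hF.measurable.aestronglyMeasurable]

end Expectation

/-! ### The regret bound -/

section Regret

variable {n m : ℕ} {A : ℕ → Matrix (Fin n) (Fin n) ℝ} {π : ℕ → Fin n → ℝ} {C lam θ : ℝ}
  {K : Set (Vec m)} {r R G ξ μ : ℝ} {α : ℕ → ℝ} {f : Fin n → ℕ → Vec m → ℝ} {x₀ : Fin n → Vec m}
  {xs : ℕ → Vec m}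

/-- The sum of the linearized regrets, along every trajectory of the algorithm. -/
theorem sum_inner_oracle_le (hM : MixingData A π C lam θ) (hA : ∀ t i j, 0 ≤ A t i j)
    (hC : 0 ≤ C) (hlam : 0 ≤ lam) (hθ : 0 < θ) (h : CostAssumption K r R G f)
    (hf : ∀ i t, LipschitzWith G.toNNReal (f i t)) (hxs : ∀ t, xs t ∈ K)
    (hξ : ξ ∈ Set.Ioo (0 : ℝ) 1) (hμ : 0 < μ) (hα : ∀ t, 0 < α t) (hanti : Antitone α)
    (hx₀ : ∀ i, x₀ i ∈ (1 - ξ) • K) (z : Fin n → ℕ → UnitSphere m) :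
    (∀ t i, ‖decision A K ξ μ α f x₀ z t i - weightedMean π (decision A K ξ μ α f x₀ z) t‖ ≤
      disagreement n C lam θ (m * G) (∑ j, ‖x₀ j‖) α t) ∧
    ∀ T, ∑ t ∈ Finset.range (T + 1), ∑ i, π (t + 1) i / phi A (t + 1) i *
      inner ℝ (oracle (f i t) μ (z i t) (decision A K ξ μ α f x₀ z t i))
        (decision A K ξ μ α f x₀ z t i - (1 - ξ) • xs t) ≤
      ∑ t ∈ Finset.range (T + 1),
        (θ * (m * G) * ((1 + lam) * disagreement n C lam θ (m * G) (∑ j, ‖x₀ j‖) α t) +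
          θ ^ 2 * (m * G) ^ 2 / 2 * α t) +
      (2 * R ^ 2 / α T + 2 * R / α T * pathVariation xs T) := by
  have h1ξ : 0 < 1 - ξ := by linarith [hξ.2]
  have hle : ∀ {x : Vec m}, x ∈ (1 - ξ) • K → ‖x‖ ≤ R := by
    rintro x ⟨k, hk, rfl⟩
    simp only [norm_smul, Real.norm_of_nonneg h1ξ.le]
    exact (mul_le_of_le_one_left (norm_nonneg _) (by linarith [hξ.1])).trans (h.norm_le hk)
  obtain ⟨x, hx⟩ : ∃ x, x = decision A K ξ μ α f x₀ z := ⟨_, rfl⟩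
  have hxK : ∀ t i, x t i ∈ (1 - ξ) • K := fun t i => hx ▸ decision_mem h hξ hx₀ z t i
  have hx0 : x 0 = x₀ := by rw [hx]; rfl
  have hy : ∀ t, (1 - ξ) • xs t ∈ (1 - ξ) • K := fun t => Set.smul_mem_smul_set (hxs t)
  have key : ∀ t, _ := fun t => sum_inner_le_of_projected_step hM hA hC hlam hθ
    (h.nonempty_smul (ξ := ξ)) (h.isClosed_smul hξ) (h.convex_set.smul _) hα
    (mul_nonneg (Nat.cast_nonneg m) h.G_pos.le)
    (x := x) (g := fun t i => oracle (f i t) μ (z i t) (x t i))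
    (fun i => hxK 0 i) (fun t i => by rw [hx]; rfl)
    (fun t i => by
      have := norm_oracle_le (hf i t) hμ (z i t) (x t i)
      rwa [Real.coe_toNNReal _ h.G_pos.le] at this) t (hy t)
  rw [hx0] at key
  rw [← hx]
  refine ⟨fun t => (key t).1, fun T => ?_⟩
  refine (Finset.sum_le_sum fun t _ => (key t).2).trans ?_
  rw [Finset.sum_add_distrib]
  refine add_le_add le_rfl ((sum_weighted_spread_le hM hα hanti (fun t i => hle (hxK t i))
    (fun t => hle (hy t)) T).trans ?_)
  have hαT := hα T
  have hR := h.R_pos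
  -- The comparators are `(1 - ξ) x*_t`, whose path is no longer than that of `x*_t`.
  refine add_le_add le_rfl (mul_le_mul_of_nonneg_left ?_ (by positivity))
  refine Finset.sum_le_sum fun t _ => ?_
  rw [← smul_sub, norm_smul, Real.norm_of_nonneg h1ξ.le]
  exact mul_le_of_le_one_left (norm_nonneg _) (by linarith [hξ.1])

/-- Beyond the linearized regret, each term pays `μ * G` for the oracle, `G` times the disagreement
for replacing `x_{i,t}` by the weighted mean, and `G * (ξ * R)` for shrinking the comparator. -/
theorem regret_bound_of_lipschitz (hm : 0 < m) (hM : MixingData A π C lam θ)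
    (hA : ∀ t i j, 0 ≤ A t i j) (hC : 0 ≤ C) (hlam : 0 ≤ lam) (hθ : 0 < θ)
    (h : CostAssumption K r R G f) (hf : ∀ i t, LipschitzWith G.toNNReal (f i t))
    (hxs : ∀ t, xs t ∈ K) (hξ : ξ ∈ Set.Ioo (0 : ℝ) 1) (hμ : μ ∈ Set.Ioc 0 (r * ξ))
    (hα : ∀ t, 0 < α t) (hanti : Antitone α) (hx₀ : ∀ i, x₀ i ∈ (1 - ξ) • K)
    {S : Type*} [MeasurableSpace S] {P : Measure S} [IsProbabilityMeasure P]
    {ζ : Fin n → ℕ → S → UnitSphere m} (hζ : RandomDirections P ζ) {xbar : ℕ → S → Vec m}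
    (hxbar : ∀ t ω, xbar t ω =
      weightedMean π (decision A K ξ μ α f x₀ fun i s => ζ i s ω) t) :
    (∀ t i, Integrable (fun ω => f i t (xbar t ω) - f i t (xs t)) P) ∧
    ∀ T, ∑ t ∈ Finset.range (T + 1), ∑ i, π (t + 1) i / phi A (t + 1) i *
        ∫ ω, (f i t (xbar t ω) - f i t (xs t)) ∂P ≤
      ∑ t ∈ Finset.range (T + 1),
        (θ * (m * G) * ((1 + lam) * disagreement n C lam θ (m * G) (∑ j, ‖x₀ j‖) α t) +
          θ ^ 2 * (m * G) ^ 2 / 2 * α t) +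
      (2 * R ^ 2 / α T + 2 * R / α T * pathVariation xs T) +
      ∑ t ∈ Finset.range (T + 1),
        θ * (μ * G + G * disagreement n C lam θ (m * G) (∑ j, ‖x₀ j‖) α t + G * (ξ * R)) := by
  have h1ξ : 0 < 1 - ξ := by linarith [hξ.2]
  have hG := h.G_pos
  have hR := h.R_pos
  have hφ := hM.phi_pos hθ
  have hcoe : ((G.toNNReal : NNReal) : ℝ) = G := Real.coe_toNNReal _ hG.le
  set D := disagreement n C lam θ (m * G) (∑ j, ‖x₀ j‖) α with hD
  have htraj := fun ω => sum_inner_oracle_le hM hA hC hlam hθ h hf hxs hξ hμ.1 hα hanti hx₀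
    fun i s => ζ i s ω
  obtain ⟨x, hx⟩ : ∃ x : S → ℕ → Fin n → Vec m,
    ∀ ω, decision A K ξ μ α f x₀ (fun i s => ζ i s ω) = x ω := ⟨_, fun _ => rfl⟩
  have hxm : ∀ t i, Measurable fun ω => x ω t i := fun t i => by
    simp only [← hx]
    exact measurable_decision h hξ (fun i t => (hf i t).continuous) t
      (fun j s _ => hζ.measurable j s) i
  have hind : ∀ t i, IndepFun (ζ i t) (fun ω => x ω t i) P := fun t i => by
    simp only [← hx]
    exact hζ.indepFun_decision h hξ (fun i t => (hf i t).continuous) t i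
  have hxK : ∀ ω t i, x ω t i ∈ (1 - ξ) • K := fun ω t i => by
    rw [← hx]
    exact decision_mem h hξ hx₀ _ t i
  simp only [hx] at htraj hxbar
  have hball : ∀ ω t i, Metric.closedBall (x ω t i) μ ⊆ K := fun ω t i =>
    h.closedBall_subset hξ hμ.2 (hxK ω t i)
  have hself : ∀ y : Vec m, y ∈ Metric.closedBall y μ := fun y => by simpa using hμ.1.le
  have hyball : ∀ t, Metric.closedBall ((1 - ξ) • xs t) μ ⊆ K := fun t =>
    h.closedBall_subset hξ hμ.2 (Set.smul_mem_smul_set (hxs t))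
  have hor : ∀ t i, _ := fun t i => integral_sub_le_integral_inner_oracle hm (hxm t i)
    (hζ.measurable i t) (hζ.uniform i t) (hind t i) (hf i t) (h.convex_cost i t) hμ.1
    (fun ω => hball ω t i) (hyball t) (R := 2 * R) fun ω => by
      have h1 := h.norm_le (hball ω t i (hself _))
      have h2 := h.norm_le (hyball t (hself _))
      exact (norm_sub_le _ _).trans (by linarith)
  rw [hcoe] at hor
  have hlip : ∀ i t (a b : Vec m), f i t a - f i t b ≤ G * ‖a - b‖ := fun i t a b => by
    have := (hf i t).dist_le_mul a b
    rw [hcoe, Real.dist_eq, dist_eq_norm] at this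
    exact (le_abs_self _).trans this
  have hxbm : ∀ t, Measurable (xbar t) := fun t => by
    have : xbar t = fun ω => ∑ i, π t i • x ω t i := funext fun ω => hxbar t ω
    rw [this]
    exact Finset.measurable_fun_sum _ fun i _ => (hxm t i).fun_const_smul _
  have hxbarK : ∀ t ω, xbar t ω ∈ K := fun t ω => by
    rw [hxbar]
    exact h.convex_set.sum_mem (fun i _ => hM.nonneg t i) (hM.sum_eq_one t)
      fun i _ => hball ω t i (hself _)
  have hint : ∀ t i, Integrable (fun ω => f i t (xbar t ω) - f i t (xs t)) P := fun t i => by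
    refine integrable_of_abs_le (c := G * (2 * R))
      (((hf i t).continuous.measurable.comp (hxbm t)).sub_const _) fun ω => ?_
    have h1 := (hf i t).dist_le_mul (xbar t ω) (xs t)
    rw [hcoe, Real.dist_eq, dist_eq_norm] at h1
    refine h1.trans (mul_le_mul_of_nonneg_left ?_ hG.le)
    have h2 := h.norm_le (hxbarK t ω)
    have h3 := h.norm_le (hxs t)
    exact (norm_sub_le _ _).trans (by linarith)
  refine ⟨hint, fun T => ?_⟩
  set I : ℕ → Fin n → S → ℝ := fun t i ω =>
    inner ℝ (oracle (f i t) μ (ζ i t ω) (x ω t i)) (x ω t i - (1 - ξ) • xs t) with hI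
  have hIint : ∀ t i, Integrable (I t i) P := fun t i => (hor t i).2.1
  have hw : ∀ t i, 0 ≤ π (t + 1) i / phi A (t + 1) i := fun t i =>
    div_nonneg (hM.nonneg _ _) (hφ _ _).le
  have hDnn : ∀ t, 0 ≤ D t := disagreement_nonneg n hC hlam hθ.le
    (mul_nonneg (Nat.cast_nonneg m) hG.le) (Finset.sum_nonneg fun _ _ => norm_nonneg _)
    fun t => (hα t).le
  have hterm : ∀ t i, ∫ ω, (f i t (xbar t ω) - f i t (xs t)) ∂P ≤
      ∫ ω, I t i ω ∂P + (μ * G + G * D t + G * (ξ * R)) := by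
    intro t i
    have h1 : ∫ ω, (f i t (xbar t ω) - f i t (xs t)) ∂P ≤
        ∫ ω, (f i t (x ω t i) - f i t ((1 - ξ) • xs t) + (G * D t + G * (ξ * R))) ∂P := by
      refine integral_mono (hint t i) ((hor t i).1.add (integrable_const _)) fun ω => ?_
      have h2 := hlip i t (xbar t ω) (x ω t i)
      have h3 := hlip i t ((1 - ξ) • xs t) (xs t)
      have h4 : ‖xbar t ω - x ω t i‖ ≤ D t := by
        rw [hxbar, norm_sub_rev]
        exact (htraj ω).1 t i
      have h5 : ‖(1 - ξ) • xs t - xs t‖ ≤ ξ * R := by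
        have : (1 - ξ) • xs t - xs t = -(ξ • xs t) := by
          rw [sub_smul, one_smul]
          abel
        rw [this, norm_neg, norm_smul, Real.norm_of_nonneg hξ.1.le]
        exact mul_le_mul_of_nonneg_left (h.norm_le (hxs t)) hξ.1.le
      have h6 := mul_le_mul_of_nonneg_left h4 hG.le
      have h7 := mul_le_mul_of_nonneg_left h5 hG.le
      simp only
      linarith
    rw [integral_add (hor t i).1 (integrable_const _)] at h1
    have h2 := (hor t i).2.2
    simp only [integral_const, probReal_univ, one_smul] at h1
    linarith
  have hsum : ∑ t ∈ Finset.range (T + 1), ∑ i, π (t + 1) i / phi A (t + 1) i * ∫ ω, I t i ω ∂P =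
      ∫ ω, ∑ t ∈ Finset.range (T + 1), ∑ i, π (t + 1) i / phi A (t + 1) i * I t i ω ∂P := by
    rw [integral_finsetSum _ fun t _ => integrable_finsetSum _ fun i _ => (hIint t i).const_mul _]
    refine Finset.sum_congr rfl fun t _ => ?_
    rw [integral_finsetSum _ fun i _ => (hIint t i).const_mul _]
    exact Finset.sum_congr rfl fun i _ => (integral_const_mul _ _).symm
  -- The linearized bound is deterministic on each trajectory, so its expectation needs no further
  -- probability.
  have hpath := integral_mono
    (integrable_finsetSum (Finset.range (T + 1)) fun t _ =>
      integrable_finsetSum Finset.univ fun i _ =>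
        (hIint t i).const_mul (π (t + 1) i / phi A (t + 1) i))
    (integrable_const (μ := P) _) fun ω => (htraj ω).2 T
  rw [← hsum, integral_const, probReal_univ, one_smul] at hpath
  calc _ ≤ ∑ t ∈ Finset.range (T + 1), ∑ i, π (t + 1) i / phi A (t + 1) i *
        (∫ ω, I t i ω ∂P + (μ * G + G * D t + G * (ξ * R))) :=
        Finset.sum_le_sum fun t _ => Finset.sum_le_sum fun i _ =>
          mul_le_mul_of_nonneg_left (hterm t i) (hw t i)
    _ = ∑ t ∈ Finset.range (T + 1), ∑ i, π (t + 1) i / phi A (t + 1) i * ∫ ω, I t i ω ∂P +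
        ∑ t ∈ Finset.range (T + 1), (∑ i, π (t + 1) i / phi A (t + 1) i) *
          (μ * G + G * D t + G * (ξ * R)) := by
        simp only [mul_add, Finset.sum_add_distrib, Finset.sum_mul]
    _ ≤ _ := by
        refine add_le_add hpath (Finset.sum_le_sum fun t _ => ?_)
        refine mul_le_mul_of_nonneg_right (hM.sum_div_phi_le hθ (t + 1)) ?_
        have := hDnn t
        have := hμ.1
        have := hξ.1
        positivity

theorem sum_disagreement (n : ℕ) (C lam θ H X : ℝ) (α : ℕ → ℝ) (T : ℕ) :
    ∑ t ∈ Finset.range T, disagreement n C lam θ H X α t =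
      C * X * ∑ t ∈ Finset.range T, lam ^ t + n * H * θ * C *
        ∑ t ∈ Finset.range T, ∑ l ∈ Finset.Icc 1 t, lam ^ (t - l) * α (l - 1) := by
  simp only [disagreement, Finset.sum_add_distrib, ← Finset.mul_sum, ← Finset.sum_mul]
  ring

theorem sum_disagreement_succ (n : ℕ) (C lam θ H X : ℝ) (α : ℕ → ℝ) (T : ℕ) :
    ∑ t ∈ Finset.range T, disagreement n C lam θ H X α (t + 1) =
      C * X * lam * ∑ t ∈ Finset.range T, lam ^ t + n * H * θ * C *
        ∑ t ∈ Finset.range T, ∑ l ∈ Finset.Icc 1 (t + 1), lam ^ (t + 1 - l) * α (l - 1) := by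
  simp only [disagreement, Finset.sum_add_distrib, ← Finset.mul_sum, ← Finset.sum_mul, pow_succ]
  ring

theorem regret_bound (hm : 0 < m) (hM : MixingData A π C lam θ)
    (hA : ∀ t i j, 0 ≤ A t i j) (hC : 0 ≤ C) (hlam : 0 ≤ lam) (hθ : 0 < θ)
    (h : CostAssumption K r R G f)
    (hxs : ∀ t, xs t ∈ K) (hξ : ξ ∈ Set.Ioo (0 : ℝ) 1) (hμ : μ ∈ Set.Ioc 0 (r * ξ))
    (hα : ∀ t, 0 < α t) (hanti : Antitone α) (hx₀ : ∀ i, x₀ i ∈ (1 - ξ) • K)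
    {S : Type*} [MeasurableSpace S] {P : Measure S} [IsProbabilityMeasure P]
    {ζ : Fin n → ℕ → S → UnitSphere m} (hζ : RandomDirections P ζ) {xbar : ℕ → S → Vec m}
    (hxbar : ∀ t ω, xbar t ω =
      weightedMean π (decision A K ξ μ α f x₀ fun i s => ζ i s ω) t) {L : ℝ}
    (hL : L = m * G / μ) :
    (∀ t i, Integrable (fun ω => f i t (xbar t ω) - f i t (xs t)) P) ∧
    ∀ T : ℕ, ∑ t ∈ Finset.range (T + 1), ∑ i, π (t + 1) i / phi A (t + 1) i *
        ∫ ω, (f i t (xbar t ω) - f i t (xs t)) ∂P ≤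
      2 * n * m * θ ^ 2 * R * L * C * G *
          ∑ t ∈ Finset.range (T + 1), ∑ l ∈ Finset.Icc 1 t, lam ^ (t - l) * α (l - 1)
        + m ^ 2 * θ ^ 2 * G ^ 2 / 2 * ∑ t ∈ Finset.range (T + 1), α t
        + 2 * n * m ^ 2 * θ ^ 2 * C * G ^ 2 *
          ∑ t ∈ Finset.range (T + 1), ∑ l ∈ Finset.Icc 1 (t + 1),
            lam ^ (t + 1 - l) * α (l - 1)
        + 2 * R ^ 2 / α T
        + 2 * (R * L + m * G * lam) * θ * C * (∑ j, ‖x₀ j‖) *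
          ∑ t ∈ Finset.range (T + 1), lam ^ t
        + 2 * R / α T * pathVariation xs T
        + μ * θ * G * (T + 1)
        + θ * ξ * G * R * (T + 1) := by
  -- The extensions are Lipschitz everywhere but known to be convex only on `K`, which is why
  -- convexity was localized above.
  choose f' hlip heq using fun i t => (h.lipschitzOnWith i t).extend_real
  have hdec : ∀ z, decision A K ξ μ α f x₀ z = decision A K ξ μ α f' x₀ z := fun z =>
    funext fun t => decision_congr h hξ hμ hx₀ heq z t
  simp only [hdec] at hxbar
  have h' := h.congr heq
  have hxbarK : ∀ t ω, xbar t ω ∈ K := fun t ω => by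
    rw [hxbar]
    refine h.convex_set.sum_mem (fun i _ => hM.nonneg t i) (hM.sum_eq_one t) fun i _ => ?_
    exact h.closedBall_subset hξ hμ.2 (decision_mem h' hξ hx₀ _ t i)
      (Metric.mem_closedBall_self hμ.1.le)
  have hval : ∀ t i ω, f i t (xbar t ω) - f i t (xs t) = f' i t (xbar t ω) - f' i t (xs t) :=
    fun t i ω => by rw [heq i t (hxbarK t ω), heq i t (hxs t)]
  simp only [hval]
  obtain ⟨h1, h2⟩ := regret_bound_of_lipschitz hm hM hA hC hlam hθ h' hlip hxs hξ hμ hα hanti hx₀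
    hζ hxbar
  refine ⟨h1, fun T => (h2 T).trans ?_⟩
  have hG := h.G_pos
  have hm1 : (1 : ℝ) ≤ m := by exact_mod_cast hm
  have hH : 0 ≤ m * G := by positivity
  -- Because `μ ≤ r * ξ ≤ r ≤ R`.
  have hRL : m * G ≤ R * L := by
    have h3 : μ ≤ R := by
      have := h.le_radius hm
      have := mul_le_of_le_one_right h.r_pos.le hξ.2.le
      linarith [hμ.2]
    rw [hL, mul_div_assoc', le_div_iff₀ hμ.1, mul_comm R]
    exact mul_le_mul_of_nonneg_left h3 hH
  have e1 := sum_disagreement n C lam θ (m * G) (∑ j, ‖x₀ j‖) α (T + 1)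
  have e2 := sum_disagreement_succ n C lam θ (m * G) (∑ j, ‖x₀ j‖) α (T + 1)
  set D := disagreement n C lam θ (m * G) (∑ j, ‖x₀ j‖) α with hDdef
  have hDnn : ∀ t, 0 ≤ D t := disagreement_nonneg n hC hlam hθ.le hH
    (Finset.sum_nonneg fun _ _ => norm_nonneg _) fun t => (hα t).le
  have hDs : ∀ t, lam * D t ≤ D (t + 1) := fun t => by
    rw [hDdef, disagreement_succ]
    have := (hα t).le
    exact le_add_of_nonneg_right (by positivity)
  -- A deliberate weakening to the stated form: `G ≤ m * G ≤ R * L` and `lam * D t ≤ D (t + 1)`. The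
  -- sums of `D t` and `D (t + 1)` give the two double sums and the terms in the initial decisions.
  have hstep : ∀ t, θ * (m * G) * ((1 + lam) * D t) + θ ^ 2 * (m * G) ^ 2 / 2 * α t +
      θ * (μ * G + G * D t + G * (ξ * R)) ≤
      2 * θ * (R * L) * D t + 2 * θ * (m * G) * D (t + 1) + θ ^ 2 * (m * G) ^ 2 / 2 * α t +
        (μ * θ * G + θ * ξ * G * R) := fun t => by
    have i1 : G * D t ≤ m * G * D t :=
      mul_le_mul_of_nonneg_right (le_mul_of_one_le_left hG.le hm1) (hDnn t)
    have i2 : m * G * D t ≤ R * L * D t := mul_le_mul_of_nonneg_right hRL (hDnn t)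
    have i3 : m * G * (lam * D t) ≤ m * G * D (t + 1) := mul_le_mul_of_nonneg_left (hDs t) hH
    have i4 : 0 ≤ m * G * D (t + 1) := mul_nonneg hH (hDnn _)
    have i5 : m * G * D t + m * G * (lam * D t) + G * D t ≤
        2 * (R * L * D t) + 2 * (m * G * D (t + 1)) := by linarith
    have i6 := mul_le_mul_of_nonneg_left i5 hθ.le
    linarith
  calc _ = ∑ t ∈ Finset.range (T + 1), (θ * (m * G) * ((1 + lam) * D t) +
        θ ^ 2 * (m * G) ^ 2 / 2 * α t + θ * (μ * G + G * D t + G * (ξ * R))) +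
        (2 * R ^ 2 / α T + 2 * R / α T * pathVariation xs T) := by
        simp only [Finset.sum_add_distrib]
        ring
    _ ≤ ∑ t ∈ Finset.range (T + 1), (2 * θ * (R * L) * D t + 2 * θ * (m * G) * D (t + 1) +
        θ ^ 2 * (m * G) ^ 2 / 2 * α t + (μ * θ * G + θ * ξ * G * R)) +
        (2 * R ^ 2 / α T + 2 * R / α T * pathVariation xs T) :=
        add_le_add (Finset.sum_le_sum fun t _ => hstep t) le_rfl
    _ = _ := by
        simp only [Finset.sum_add_distrib, ← Finset.mul_sum, e1, e2, Finset.sum_const,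
          Finset.card_range, nsmul_eq_mul, Nat.cast_add, Nat.cast_one]
        ring

end Regret

end BanditOnline

/-- First part: the sequence `π` and the constants `C`, `λ`, `θ` exist, with constants that depend on
`n`, `γ` and `B` only. Second part: the bound, for every choice of such data. -/
theorem theorem1 {n m : ℕ} (hn : 0 < n) (hm : 0 < m) {γ : ℝ} (hγ : γ ∈ Set.Ioo (0 : ℝ) 1)
    {B : ℕ} (hB : 0 < B) :
    (∃ C > (0 : ℝ), ∃ lam ∈ Set.Ioo (0 : ℝ) 1, ∃ θ > (0 : ℝ),
      ∀ (𝒢 : ℕ → Digraph (Fin n)) (A : ℕ → Matrix (Fin n) (Fin n) ℝ),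
        BanditOnline.NetworkAssumption 𝒢 A γ B →
          ∃ π : ℕ → Fin n → ℝ, BanditOnline.MixingData A π C lam θ) ∧
    ∀ (𝒢 : ℕ → Digraph (Fin n)) (A : ℕ → Matrix (Fin n) (Fin n) ℝ),
      BanditOnline.NetworkAssumption 𝒢 A γ B →
      ∀ C > (0 : ℝ), ∀ lam ∈ Set.Ioo (0 : ℝ) 1, ∀ θ > (0 : ℝ), ∀ π : ℕ → Fin n → ℝ,
      BanditOnline.MixingData A π C lam θ →
      ∀ (K : Set (BanditOnline.Vec m)) (r R G : ℝ) (f : Fin n → ℕ → BanditOnline.Vec m → ℝ),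
      BanditOnline.CostAssumption K r R G f →
      ∀ xs : ℕ → BanditOnline.Vec m, BanditOnline.IsMinimizerSequence K f xs →
      ∀ ξ ∈ Set.Ioo (0 : ℝ) 1, ∀ μ ∈ Set.Ioc 0 (r * ξ),
      ∀ α : ℕ → ℝ, (∀ t, 0 < α t) → Antitone α →
      ∀ x₀ : Fin n → BanditOnline.Vec m, (∀ i, x₀ i ∈ (1 - ξ) • K) →
      ∀ (S : Type*) [MeasurableSpace S] (P : MeasureTheory.Measure S)
        [MeasureTheory.IsProbabilityMeasure P] (ζ : Fin n → ℕ → S → BanditOnline.UnitSphere m),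
      BanditOnline.RandomDirections P ζ →
      ∀ xbar : ℕ → S → BanditOnline.Vec m,
      (∀ t ω, xbar t ω = BanditOnline.weightedMean π
        (BanditOnline.decision A K ξ μ α f x₀ fun i s => ζ i s ω) t) →
      ∀ L : ℝ, L = m * G / μ →
      (∀ t i, MeasureTheory.Integrable (fun ω => f i t (xbar t ω) - f i t (xs t)) P) ∧
      ∀ T : ℕ,
        ∑ t ∈ Finset.range (T + 1), ∑ i,
            π (t + 1) i / BanditOnline.phi A (t + 1) i *
              ∫ ω, (f i t (xbar t ω) - f i t (xs t)) ∂P ≤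
          2 * n * m * θ ^ 2 * R * L * C * G *
              ∑ t ∈ Finset.range (T + 1), ∑ l ∈ Finset.Icc 1 t, lam ^ (t - l) * α (l - 1)
            + m ^ 2 * θ ^ 2 * G ^ 2 / 2 * ∑ t ∈ Finset.range (T + 1), α t
            + 2 * n * m ^ 2 * θ ^ 2 * C * G ^ 2 *
              ∑ t ∈ Finset.range (T + 1), ∑ l ∈ Finset.Icc 1 (t + 1),
                lam ^ (t + 1 - l) * α (l - 1)
            + 2 * R ^ 2 / α T
            + 2 * (R * L + m * G * lam) * θ * C * (∑ j, ‖x₀ j‖) *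
              ∑ t ∈ Finset.range (T + 1), lam ^ t
            + 2 * R / α T * BanditOnline.pathVariation xs T
            + μ * θ * G * (T + 1)
            + θ * ξ * G * R * (T + 1) := by
  refine ⟨BanditOnline.exists_mixing_constants hn hγ hB, ?_⟩
  intro 𝒢 A hnet C hC lam hlam θ hθ π hM K r R G f hcost xs hxs ξ hξ μ hμ α hα hanti x₀ hx₀ S _ P _ ζ
    hζ xbar hxbar L hL
  exact BanditOnline.regret_bound hm hM hnet.weight_nonneg hC.le hlam.1.le hθ hcost
    (fun t => (hxs t).1) hξ hμ hα hanti hx₀ hζ hxbar hL
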